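/- For $\theta\in(0,\pi)$ let $\hat T_\theta$ be the bounded integral operator on $L^2(\mathbb{R})$ with kernel $$\hat T_\theta(p,q)=\frac{1}{2\pi|\sin\theta|}\,\frac{1}{\frac{p^2-2\cos(\theta)\,pq+q^2}{2\sin^2\theta}+1},$$ let $\Pi\varphi(p)=\varphi(-p)$ be the parity operator, $\hat T_\theta^\pm:=\frac{1\pm\Pi}{2}\hat T_\theta$, and let $T_\theta:=F^{-1}\hat T_\theta F$, $T_\theta^\pm:=F^{-1}\hat T^\pm_\theta F$, where $F$ is the unitary Fourier transform $F\varphi(p)=(2\pi)^{-1/2}\int e^{-ipx}\varphi(x)\,dx$ on $L^2(\mathbb{R})$. Let $\|A\|_1=\operatorname{tr}|A|$ denote the trace norm. For $n\in\mathbb{N}=\{0,1,2,\dots\}$ and $s>0$ let $P_{n,s}$ be the rank one orthogonal projector on the vector $$g_{n,s}(p)=\sqrt{\frac{(2s)^{n+\frac12}}{\Gamma(n+\frac12)}}\;p^n e^{-p^2s}.$$ Theorem. For every $\theta\in(0,\pi)$ and every $n\in\mathbb N$ the function $s\mapsto s^{-1/2}e^{-2\sin^2(\theta)s}P_{n,s}$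 is Bochner integrable on $(0,\infty)$ with values in the Banach space of trace class operators, and, with convergence in the trace norm, $$\hat T_\theta=2^{-\frac12}\frac{\sin\theta}{\pi}\sum_{n=0}^\infty\frac{\Gamma(n+\frac12)}{\Gamma(n+1)}\cos^n(\theta)\int_0^\infty s^{-\frac12}e^{-2\sin^2(\theta)s}P_{n,s}\,ds,$$ $$\hat T^+_\theta=2^{-\frac12}\frac{\sin\theta}{\pi}\sum_{n=0}^\infty\frac{\Gamma(2n+\frac12)}{\Gamma(2n+1)}\cos^{2n}(\theta)\int_0^\infty s^{-\frac12}e^{-2\sin^2(\theta)s}P_{2n,s}\,ds,$$ $$\hat T^-_\theta=2^{-\frac12}\frac{\sin\theta}{\pi}\sum_{n=0}^\infty\frac{\Gamma(2n+\frac32)}{\Gamma(2n+2)}\cos^{2n+1}(\theta)\int_0^\infty s^{-\frac12}e^{-2\sin^2(\theta)s}P_{2n+1,s}\,ds.$$ If $\theta\in(0,\frac\pi2]$ then $\hat T^+_\theta\ge0$ and $\hat T^-_\theta\ge0$; if $\theta\in[\frac\pi2,\pi)$ then $\hat T^+_\theta\ge0$ and $-\hat T^-_\theta\ge0$. Moreover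 $T_\theta$ and $T_\theta^\pm$ (and likewise $\hat T_\theta$ and $\hat T_\theta^\pm$, with the same traces and trace norms) are trace class, and $$\operatorname{tr}T^+_\theta=\|T^+_\theta\|_1=\frac{\cos\frac\theta2+\sin\frac\theta2}{2\sqrt2\,\sin\theta},$$ $$\operatorname{tr}T^-_\theta=\frac{\cos\frac\theta2-\sin\frac\theta2}{2\sqrt2\,\sin\theta},\qquad \|T^-_\theta\|_1=\frac{\left|\cos\frac\theta2-\sin\frac\theta2\right|}{2\sqrt2\,\sin\theta},$$ $$\operatorname{tr}T_\theta=\frac1{2\sqrt2\,\sin\frac\theta2},\qquad \|T_\theta\|_1=\frac{\max\{\cos\frac\theta2,\sin\frac\theta2\}}{\sqrt2\,\sin\theta}.$$ -/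

import Mathlib

open MeasureTheory Set Filter Topology
open scoped InnerProductSpace ENNReal NNReal

noncomputable section

/-! ### Trace class operators on a Hilbert space -/

section TraceClass

universe u

variable {H : Type u} [NormedAddCommGroup H] [InnerProductSpace ℂ H] [CompleteSpace H]

/-- The index set of a fixed orthonormal (Hilbert) basis of `H`. -/
def onbIndex (H : Type u) [NormedAddCommGroup H] [InnerProductSpace ℂ H] [CompleteSpace H] :
    Set H :=
  (exists_hilbertBasis ℂ H).choose

/-- A fixed orthonormal (Hilbert) basis of `H`. -/
def onb (H : Type u) [NormedAddCommGroup H] [InnerProductSpace ℂ H] [CompleteSpace H] :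
    HilbertBasis (onbIndex H) ℂ H :=
  (exists_hilbertBasis ℂ H).choose_spec.choose

/-- The trace norm `‖T‖₁ = tr |T| = ∑ i, ⟪e i, |T| e i⟫` in `[0, ∞]`, where `|T| = (T* T)^(1/2)`. -/
def traceNorm (T : H →L[ℂ] H) : ℝ≥0∞ :=
  ∑' i, ENNReal.ofReal (RCLike.re ⟪onb H i, CFC.abs T (onb H i)⟫_ℂ)

/-- `T` is trace class if its trace norm is finite. -/
def IsTraceClass (T : H →L[ℂ] H) : Prop := traceNorm T < ∞

/-- `T` has trace `τ`: for every orthonormal basis `b`, the series `∑ i, ⟪b i, T b i⟫` converges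
(absolutely) to `τ`. -/
def HasTrace (T : H →L[ℂ] H) (τ : ℂ) : Prop :=
  ∀ (ι : Type u) (b : HilbertBasis ι ℂ H), HasSum (fun i => ⟪b i, T (b i)⟫_ℂ) τ

/-- The square of the Hilbert-Schmidt norm (an auxiliary quantity). -/
def hsSq (S : H →L[ℂ] H) : ℝ≥0∞ := ∑' i, ENNReal.ofReal (‖S (onb H i)‖ ^ 2)

theorem tsum_ofReal_norm_inner_sq {H : Type u} [NormedAddCommGroup H] [InnerProductSpace ℂ H]
    {ι : Type*} (b : HilbertBasis ι ℂ H) (x : H) :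
    ∑' i, ENNReal.ofReal (‖⟪b i, x⟫_ℂ‖ ^ 2) = ENNReal.ofReal (‖x‖ ^ 2) := by
  have h := b.hasSum_inner_mul_inner x x
  have h2 : HasSum (fun i => ‖⟪b i, x⟫_ℂ‖ ^ 2) (‖x‖ ^ 2) := by
    have h3 := (Complex.hasSum_re h)
    convert h3 using 1
    · ext i
      rw [← inner_conj_symm x (b i), ← Complex.normSq_eq_conj_mul_self, Complex.ofReal_re,
        Complex.normSq_eq_norm_sq]
    · exact norm_sq_eq_re_inner (𝕜 := ℂ) x
  rw [← ENNReal.ofReal_tsum_of_nonneg (fun i => by positivity) h2.summable, h2.tsum_eq]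

theorem hsSq_adjoint (S : H →L[ℂ] H) : hsSq (star S) = hsSq S := by
  unfold hsSq
  calc ∑' i, ENNReal.ofReal (‖(star S) (onb H i)‖ ^ 2)
      = ∑' i, ∑' j, ENNReal.ofReal (‖⟪onb H j, (star S) (onb H i)⟫_ℂ‖ ^ 2) := by
        simp_rw [tsum_ofReal_norm_inner_sq]
    _ = ∑' j, ∑' i, ENNReal.ofReal (‖⟪onb H j, (star S) (onb H i)⟫_ℂ‖ ^ 2) := ENNReal.tsum_comm
    _ = ∑' j, ∑' i, ENNReal.ofReal (‖⟪onb H i, S (onb H j)⟫_ℂ‖ ^ 2) := by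
        congr! 5 with j i
        rw [ContinuousLinearMap.star_eq_adjoint, ContinuousLinearMap.adjoint_inner_right,
          norm_inner_symm]
    _ = _ := by simp_rw [tsum_ofReal_norm_inner_sq]

theorem hsSq_mul_le (X S : H →L[ℂ] H) (hX : ‖X‖ ≤ 1) : hsSq (X * S) ≤ hsSq S := by
  refine ENNReal.tsum_le_tsum fun i => ENNReal.ofReal_le_ofReal ?_
  have : ‖X (S (onb H i))‖ ≤ 1 * ‖S (onb H i)‖ := X.le_of_opNorm_le hX _
  rw [one_mul] at this
  exact pow_le_pow_left₀ (norm_nonneg _) this 2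

theorem hsSq_mul_le' (S X : H →L[ℂ] H) (hX : ‖X‖ ≤ 1) : hsSq (S * X) ≤ hsSq S := by
  rw [← hsSq_adjoint, star_mul, ← hsSq_adjoint S]
  exact hsSq_mul_le _ _ (by rwa [norm_star])

theorem norm_sq_le_hsSq (S : H →L[ℂ] H) : ENNReal.ofReal (‖S‖ ^ 2) ≤ hsSq S := by
  by_cases hS : hsSq S = ∞
  · simp [hS]
  have key : ∀ x, ‖S x‖ ≤ √(hsSq S).toReal * ‖x‖ := by
    intro x
    have h1 : ENNReal.ofReal (‖S x‖ ^ 2) ≤ hsSq S * ENNReal.ofReal (‖x‖ ^ 2) := by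
      rw [← tsum_ofReal_norm_inner_sq (onb H), ← hsSq_adjoint, hsSq, ← ENNReal.tsum_mul_right]
      refine ENNReal.tsum_le_tsum fun i => ?_
      rw [← ENNReal.ofReal_mul (by positivity)]
      refine ENNReal.ofReal_le_ofReal ?_
      rw [← mul_pow, ← ContinuousLinearMap.adjoint_inner_left,
        ContinuousLinearMap.star_eq_adjoint]
      exact pow_le_pow_left₀ (norm_nonneg _) (norm_inner_le_norm _ _) 2
    rw [← ENNReal.ofReal_toReal hS, ← ENNReal.ofReal_mul ENNReal.toReal_nonneg,
      ENNReal.ofReal_le_ofReal_iff (by positivity)] at h1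
    have := Real.sqrt_le_sqrt h1
    rwa [Real.sqrt_sq (norm_nonneg _), Real.sqrt_mul ENNReal.toReal_nonneg,
      Real.sqrt_sq (norm_nonneg _)] at this
  have h2 := S.opNorm_le_bound (Real.sqrt_nonneg _) key
  rw [← ENNReal.ofReal_toReal hS]
  refine ENNReal.ofReal_le_ofReal ?_
  have := pow_le_pow_left₀ (norm_nonneg _) h2 2
  rwa [Real.sq_sqrt ENNReal.toReal_nonneg] at this

theorem norm_abs_apply (T : H →L[ℂ] H) (x : H) : ‖CFC.abs T x‖ = ‖T x‖ := by
  have hA : star (CFC.abs T) = CFC.abs T := (CFC.abs_nonneg T).isSelfAdjoint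
  have h : star (CFC.abs T) * CFC.abs T = star T * T := by rw [hA, CFC.abs_mul_abs]
  have h2 := congrArg (fun X : H →L[ℂ] H => ⟪x, X x⟫_ℂ) h
  simp only [mul_apply_eq_comp, ContinuousLinearMap.star_eq_adjoint,
    ContinuousLinearMap.adjoint_inner_right] at h2
  rw [inner_self_eq_norm_sq_to_K, inner_self_eq_norm_sq_to_K] at h2
  have h3 : ‖CFC.abs T x‖ ^ 2 = ‖T x‖ ^ 2 := by exact_mod_cast h2
  exact (sq_eq_sq₀ (norm_nonneg _) (norm_nonneg _)).1 h3

/-- An approximate polar decomposition. -/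
theorem exists_approx_polar (T : H →L[ℂ] H) {ε : ℝ} (hε : 0 < ε) :
    ∃ U : H →L[ℂ] H, ‖U‖ ≤ 1 ∧ ‖T - U * CFC.abs T‖ ≤ ε ∧ ‖CFC.abs T - star U * T‖ ≤ ε := by
  set A := CFC.abs T with hAdef
  have hA0 : 0 ≤ A := CFC.abs_nonneg T
  have hA : IsSelfAdjoint A := hA0.isSelfAdjoint
  have hspec : ∀ x ∈ spectrum ℝ A, 0 ≤ x := fun x hx => spectrum_nonneg_of_nonneg hA0 hx
  have hcont : ContinuousOn (fun x : ℝ => (x + ε)⁻¹) (spectrum ℝ A) := by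
    refine ContinuousOn.inv₀ (by fun_prop) fun x hx => ?_
    have := hspec x hx
    positivity
  set B := cfc (fun x : ℝ => (x + ε)⁻¹) A with hB
  have hBs : star B = B := (cfc_predicate (fun x : ℝ => (x + ε)⁻¹) A : IsSelfAdjoint B)
  have hAB : A * B = cfc (fun x : ℝ => x * (x + ε)⁻¹) A := by
    rw [cfc_mul (fun x : ℝ => x) _ A (by fun_prop) hcont, cfc_id' ℝ A]
  have hBA : B * A = cfc (fun x : ℝ => x * (x + ε)⁻¹) A := by
    have : (fun x : ℝ => x * (x + ε)⁻¹) = fun x => (x + ε)⁻¹ * x := by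
      ext x; ring
    rw [this, cfc_mul _ (fun x : ℝ => x) A hcont (by fun_prop), cfc_id' ℝ A]
  have hABn : ‖A * B‖ ≤ 1 := by
    rw [hAB]
    refine norm_cfc_le zero_le_one fun x hx => ?_
    have := hspec x hx
    rw [Real.norm_of_nonneg (by positivity), ← div_eq_mul_inv, div_le_one (by positivity)]
    linarith
  have hcomp : 1 - B * A = ε • B := by
    rw [hBA, hB, ← cfc_one ℝ A, ← cfc_sub _ _ A (by fun_prop) (by fun_prop), ← cfc_smul _ _ A hcont]
    refine cfc_congr fun x hx => ?_
    have := hspec x hx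
    have : x + ε ≠ 0 := by positivity
    simp only [Pi.one_apply, smul_eq_mul]
    field_simp
    ring
  have hTB : ‖T * B‖ ≤ 1 := by
    refine ContinuousLinearMap.opNorm_le_bound _ zero_le_one fun x => ?_
    rw [mul_apply_eq_comp, ← norm_abs_apply, ← mul_apply_eq_comp]
    exact (A * B).le_of_opNorm_le hABn x
  refine ⟨T * B, hTB, ?_, ?_⟩
  · have : T - T * B * A = ε • (T * B) := by
      rw [mul_assoc, ← mul_smul_comm, ← hcomp, mul_sub, mul_one]
    rw [this, norm_smul, Real.norm_of_nonneg hε.le]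
    nlinarith
  · have : A - star (T * B) * T = ε • (A * B) := by
      rw [star_mul, hBs, mul_assoc, ← CFC.abs_mul_abs, ← hAdef, ← mul_assoc, hBA.trans hAB.symm,
        mul_assoc, ← mul_smul_comm, ← hcomp, mul_sub, mul_one]
    rw [this, norm_smul, Real.norm_of_nonneg hε.le]
    nlinarith

theorem re_inner_abs (T : H →L[ℂ] H) (x : H) :
    RCLike.re ⟪x, CFC.abs T x⟫_ℂ = ‖CFC.sqrt (CFC.abs T) x‖ ^ 2 := by
  have hS : star (CFC.sqrt (CFC.abs T)) = CFC.sqrt (CFC.abs T) :=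
    (CFC.sqrt_nonneg (CFC.abs T)).isSelfAdjoint
  conv_lhs => rw [← CFC.sqrt_mul_sqrt_self (CFC.abs T) (CFC.abs_nonneg T)]
  rw [mul_apply_eq_comp]
  conv_lhs => enter [2, 3]; rw [← hS]
  rw [ContinuousLinearMap.star_eq_adjoint, ContinuousLinearMap.adjoint_inner_right,
    ← ContinuousLinearMap.star_eq_adjoint, hS, ← norm_sq_eq_re_inner]

theorem traceNorm_eq_hsSq (T : H →L[ℂ] H) : traceNorm T = hsSq (CFC.sqrt (CFC.abs T)) := by
  simp only [traceNorm, hsSq, re_inner_abs]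

/-- The variational upper bound for the trace norm. -/
theorem sum_norm_inner_le_traceNorm (T W : H →L[ℂ] H) (hW : ‖W‖ ≤ 1)
    (F : Finset (onbIndex H)) :
    ENNReal.ofReal (∑ i ∈ F, ‖⟪W (onb H i), T (onb H i)⟫_ℂ‖) ≤ traceNorm T := by
  set S := CFC.sqrt (CFC.abs T) with hSdef
  have hS : star S = S := (CFC.sqrt_nonneg (CFC.abs T)).isSelfAdjoint
  have hSS : S * S = CFC.abs T := CFC.sqrt_mul_sqrt_self _ (CFC.abs_nonneg T)
  rw [traceNorm_eq_hsSq, ← hSdef]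
  by_cases htop : hsSq S = ∞
  · simp [htop]
  have hbound : ∀ X : H →L[ℂ] H, ‖X‖ ≤ 1 →
      ∑ i ∈ F, ‖(S * X) (onb H i)‖ ^ 2 ≤ (hsSq S).toReal := by
    intro X hX
    have h1 : ENNReal.ofReal (∑ i ∈ F, ‖(S * X) (onb H i)‖ ^ 2) ≤ hsSq S := by
      rw [ENNReal.ofReal_sum_of_nonneg (fun i _ => by positivity)]
      exact (ENNReal.sum_le_tsum F).trans (hsSq_mul_le' S X hX)
    exact (ENNReal.ofReal_le_iff_le_toReal htop).1 h1
  rw [ENNReal.ofReal_le_iff_le_toReal htop]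
  have key : ∀ ε : ℝ, 0 < ε →
      ∑ i ∈ F, ‖⟪W (onb H i), T (onb H i)⟫_ℂ‖ ≤ (hsSq S).toReal + ε * F.card := by
    intro ε hε
    obtain ⟨U, hU, hUT, -⟩ := exists_approx_polar T hε
    have hUW : ‖star U * W‖ ≤ 1 := by
      refine (norm_mul_le _ _).trans ?_
      rw [norm_star]
      exact mul_le_one₀ hU (norm_nonneg _) hW
    have hterm : ∀ i ∈ F, ‖⟪W (onb H i), T (onb H i)⟫_ℂ‖ ≤
        (‖(S * (star U * W)) (onb H i)‖ ^ 2 + ‖(S * 1) (onb H i)‖ ^ 2) / 2 + ε := by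
      intro i _
      have hn : ‖onb H i‖ = 1 := (onb H).orthonormal.1 i
      have hsplit : ⟪W (onb H i), T (onb H i)⟫_ℂ =
          ⟪(S * (star U * W)) (onb H i), S (onb H i)⟫_ℂ +
            ⟪W (onb H i), (T - U * CFC.abs T) (onb H i)⟫_ℂ := by
        rw [← hSS]
        simp only [sub_apply, mul_apply_eq_comp, inner_sub_right]
        conv_rhs => enter [1, 2]; rw [← hS]
        rw [ContinuousLinearMap.star_eq_adjoint, ContinuousLinearMap.star_eq_adjoint,
          ContinuousLinearMap.adjoint_inner_left, ContinuousLinearMap.adjoint_inner_left]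
        ring
      rw [hsplit]
      refine (norm_add_le _ _).trans (add_le_add ?_ ?_)
      · refine (norm_inner_le_norm _ _).trans ?_
        rw [mul_one]
        nlinarith [sq_nonneg (‖(S * (star U * W)) (onb H i)‖ - ‖S (onb H i)‖)]
      · refine (norm_inner_le_norm _ _).trans ?_
        have h1 : ‖W (onb H i)‖ ≤ 1 * ‖onb H i‖ := W.le_of_opNorm_le hW _
        have h2 := (T - U * CFC.abs T).le_of_opNorm_le hUT (onb H i)
        rw [hn, mul_one] at h1 h2
        calc _ ≤ 1 * ε := mul_le_mul h1 h2 (norm_nonneg _) zero_le_one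
          _ = ε := one_mul _
    refine (Finset.sum_le_sum hterm).trans ?_
    rw [Finset.sum_add_distrib, ← Finset.sum_div, Finset.sum_add_distrib, Finset.sum_const,
      nsmul_eq_mul, mul_comm (F.card : ℝ)]
    have h1 := hbound _ hUW
    have h2 := hbound 1 (ContinuousLinearMap.norm_id_le)
    linarith
  refine le_of_forall_pos_le_add fun δ hδ => ?_
  have hc : (0 : ℝ) < F.card + 1 := by positivity
  refine (key (δ / (F.card + 1)) (by positivity)).trans ?_
  gcongr
  rw [div_mul_eq_mul_div, div_le_iff₀ hc]
  nlinarith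

/-- The variational characterization of the trace norm (lower bound). -/
theorem traceNorm_le_of_forall (T : H →L[ℂ] H) (C : ℝ≥0∞)
    (h : ∀ (W : H →L[ℂ] H) (_ : ‖W‖ ≤ 1) (F : Finset (onbIndex H)),
      ENNReal.ofReal (∑ i ∈ F, ‖⟪W (onb H i), T (onb H i)⟫_ℂ‖) ≤ C) : traceNorm T ≤ C := by
  by_cases hC : C = ∞
  · simp [hC]
  rw [traceNorm, ENNReal.tsum_eq_iSup_sum]
  refine iSup_le fun F => ?_
  have hpos : ∀ i, 0 ≤ RCLike.re ⟪onb H i, CFC.abs T (onb H i)⟫_ℂ := fun i => by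
    rw [re_inner_abs]; positivity
  rw [← ENNReal.ofReal_sum_of_nonneg (fun i _ => hpos i), ENNReal.ofReal_le_iff_le_toReal hC]
  refine le_of_forall_pos_le_add fun δ hδ => ?_
  have hc : (0 : ℝ) < F.card + 1 := by positivity
  obtain ⟨U, hU, -, hUA⟩ := exists_approx_polar T (show 0 < δ / (F.card + 1) by positivity)
  have h1 := (ENNReal.ofReal_le_iff_le_toReal hC).1 (h U hU F)
  have hterm : ∀ i ∈ F, RCLike.re ⟪onb H i, CFC.abs T (onb H i)⟫_ℂ ≤
      ‖⟪U (onb H i), T (onb H i)⟫_ℂ‖ + δ / (F.card + 1) := by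
    intro i _
    have hn : ‖onb H i‖ = 1 := (onb H).orthonormal.1 i
    have hsplit : ⟪onb H i, CFC.abs T (onb H i)⟫_ℂ = ⟪U (onb H i), T (onb H i)⟫_ℂ +
        ⟪onb H i, (CFC.abs T - star U * T) (onb H i)⟫_ℂ := by
      simp only [sub_apply, mul_apply_eq_comp, inner_sub_right]
      rw [ContinuousLinearMap.star_eq_adjoint, ContinuousLinearMap.adjoint_inner_right]
      ring
    refine (RCLike.re_le_norm _).trans ?_
    rw [hsplit]
    refine (norm_add_le _ _).trans (add_le_add le_rfl ?_)
    refine (norm_inner_le_norm _ _).trans ?_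
    have h2 := (CFC.abs T - star U * T).le_of_opNorm_le hUA (onb H i)
    rw [hn, mul_one] at h2
    rwa [hn, one_mul]
  refine (Finset.sum_le_sum hterm).trans ?_
  rw [Finset.sum_add_distrib, Finset.sum_const, nsmul_eq_mul]
  refine add_le_add h1 ?_
  rw [mul_div_assoc', div_le_iff₀ hc]
  nlinarith

theorem traceNorm_add_le (S T : H →L[ℂ] H) : traceNorm (S + T) ≤ traceNorm S + traceNorm T := by
  refine traceNorm_le_of_forall _ _ fun W hW F => ?_
  refine le_trans ?_ (add_le_add (sum_norm_inner_le_traceNorm S W hW F)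
    (sum_norm_inner_le_traceNorm T W hW F))
  rw [← ENNReal.ofReal_add (by positivity) (by positivity), ← Finset.sum_add_distrib]
  refine ENNReal.ofReal_le_ofReal (Finset.sum_le_sum fun i _ => ?_)
  rw [add_apply, inner_add_right]
  exact norm_add_le _ _

theorem traceNorm_smul (c : ℂ) (T : H →L[ℂ] H) :
    traceNorm (c • T) = ENNReal.ofReal ‖c‖ * traceNorm T := by
  simp only [traceNorm, CFC.abs_smul, ← ENNReal.tsum_mul_left]
  refine tsum_congr fun i => ?_
  rw [← ENNReal.ofReal_mul (norm_nonneg c), smul_apply]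
  congr 1
  rw [← Complex.coe_smul, inner_smul_right]
  exact Complex.re_ofReal_mul _ _

theorem traceNorm_zero : traceNorm (0 : H →L[ℂ] H) = 0 := by
  simp [traceNorm]

theorem opNorm_le_traceNorm (T : H →L[ℂ] H) : ENNReal.ofReal ‖T‖ ≤ traceNorm T := by
  have hS : star (CFC.sqrt (CFC.abs T)) = CFC.sqrt (CFC.abs T) :=
    (CFC.sqrt_nonneg (CFC.abs T)).isSelfAdjoint
  rw [traceNorm_eq_hsSq]
  refine le_trans (ENNReal.ofReal_le_ofReal ?_) (norm_sq_le_hsSq _)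
  refine T.opNorm_le_bound (by positivity) fun x => ?_
  rw [← norm_abs_apply]
  refine ContinuousLinearMap.le_of_opNorm_le _ ?_ x
  conv_lhs => rw [← CFC.sqrt_mul_sqrt_self (CFC.abs T) (CFC.abs_nonneg T)]
  rw [sq]
  exact norm_mul_le _ _

/-- The subspace of trace class operators. -/
def traceClass (H : Type u) [NormedAddCommGroup H] [InnerProductSpace ℂ H] [CompleteSpace H] :
    Submodule ℂ (H →L[ℂ] H) where
  carrier := {T | IsTraceClass T}
  zero_mem' := by simp [IsTraceClass, traceNorm_zero]
  add_mem' {S T} hS hT := (traceNorm_add_le S T).trans_lt (ENNReal.add_lt_top.2 ⟨hS, hT⟩)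
  smul_mem' c T hT := by
    simp only [mem_ofPred_eq, IsTraceClass, traceNorm_smul]
    exact ENNReal.mul_lt_top ENNReal.ofReal_lt_top hT

/-- The space of trace class operators, to be normed by the trace norm. -/
def TraceClass (H : Type u) [NormedAddCommGroup H] [InnerProductSpace ℂ H] [CompleteSpace H] :
    Type u :=
  ↥(traceClass H)

instance : AddCommGroup (TraceClass H) := inferInstanceAs (AddCommGroup (traceClass H))

instance : Module ℂ (TraceClass H) := inferInstanceAs (Module ℂ (traceClass H))

/-- The bounded operator underlying a trace class operator. -/
def TraceClass.toCLM : TraceClass H →ₗ[ℂ] (H →L[ℂ] H) := (traceClass H).subtype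

/-- A bounded operator with finite trace norm, as an element of the space of trace class
operators. -/
def TraceClass.mk (T : H →L[ℂ] H) (hT : IsTraceClass T) : TraceClass H := ⟨T, hT⟩

instance : Norm (TraceClass H) := ⟨fun T => (traceNorm (TraceClass.toCLM T)).toReal⟩

theorem TraceClass.isTraceClass (T : TraceClass H) : IsTraceClass T.toCLM := T.2

theorem TraceClass.toCLM_injective : Function.Injective (TraceClass.toCLM (H := H)) :=
  Subtype.val_injective

theorem TraceClass.norm_def (T : TraceClass H) : ‖T‖ = (traceNorm T.toCLM).toReal := rfl

theorem TraceClass.opNorm_le (T : TraceClass H) : ‖T.toCLM‖ ≤ ‖T‖ :=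
  (ENNReal.ofReal_le_iff_le_toReal T.isTraceClass.ne).1 (opNorm_le_traceNorm _)

theorem TraceClass.core : NormedSpace.Core ℂ (TraceClass H) where
  norm_nonneg _ := ENNReal.toReal_nonneg
  norm_smul c T := by
    rw [TraceClass.norm_def, map_smul, traceNorm_smul, ENNReal.toReal_mul,
      ENNReal.toReal_ofReal (norm_nonneg c), TraceClass.norm_def]
  norm_triangle S T := by
    rw [TraceClass.norm_def, map_add, TraceClass.norm_def, TraceClass.norm_def,
      ← ENNReal.toReal_add S.isTraceClass.ne T.isTraceClass.ne]
    exact ENNReal.toReal_mono (ENNReal.add_ne_top.2 ⟨S.isTraceClass.ne, T.isTraceClass.ne⟩)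
      (traceNorm_add_le _ _)
  norm_eq_zero_iff T := by
    constructor
    · intro h
      have h1 := T.opNorm_le
      rw [h] at h1
      have h2 : T.toCLM = 0 := norm_le_zero_iff.1 h1
      exact TraceClass.toCLM_injective (by rw [h2, map_zero])
    · rintro rfl
      rw [TraceClass.norm_def, map_zero, traceNorm_zero, ENNReal.toReal_zero]

instance : NormedAddCommGroup (TraceClass H) := NormedAddCommGroup.ofCore TraceClass.core

instance : NormedSpace ℂ (TraceClass H) := NormedSpace.ofCore TraceClass.core

/-- The space of trace class operators is complete for the trace norm. -/
instance : CompleteSpace (TraceClass H) := by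
  refine Metric.complete_of_cauchySeq_tendsto fun u hu => ?_
  have hdist : ∀ m n, dist (u m).toCLM (u n).toCLM ≤ dist (u m) (u n) := fun m n => by
    rw [dist_eq_norm, dist_eq_norm, ← map_sub]
    exact TraceClass.opNorm_le _
  have hc : CauchySeq fun n => (u n).toCLM := by
    rw [Metric.cauchySeq_iff] at hu ⊢
    intro ε hε
    obtain ⟨N, hN⟩ := hu ε hε
    exact ⟨N, fun m hm n hn => (hdist m n).trans_lt (hN m hm n hn)⟩
  obtain ⟨T, hT⟩ := cauchySeq_tendsto_of_complete hc
  have hlim : ∀ ε : ℝ, 0 < ε → ∃ N, ∀ n ≥ N,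
      traceNorm ((u n).toCLM - T) ≤ ENNReal.ofReal ε := by
    intro ε hε
    obtain ⟨N, hN⟩ := Metric.cauchySeq_iff.1 hu ε hε
    refine ⟨N, fun n hn => traceNorm_le_of_forall _ _ fun W hW F => ENNReal.ofReal_le_ofReal ?_⟩
    have ht : Tendsto (fun m => ∑ i ∈ F, ‖⟪W (onb H i), ((u n).toCLM - (u m).toCLM) (onb H i)⟫_ℂ‖)
        atTop (𝓝 (∑ i ∈ F, ‖⟪W (onb H i), ((u n).toCLM - T) (onb H i)⟫_ℂ‖)) := by
      refine tendsto_finsetSum _ fun i _ => ?_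
      have h1 : Tendsto (fun m => ((u n).toCLM - (u m).toCLM) (onb H i)) atTop
          (𝓝 (((u n).toCLM - T) (onb H i))) :=
        ((ContinuousLinearMap.apply ℂ H (onb H i)).continuous.tendsto _).comp
          (tendsto_const_nhds.sub hT)
      exact (tendsto_const_nhds.inner h1).norm
    refine le_of_tendsto ht (eventually_atTop.2 ⟨N, fun m hm => ?_⟩)
    have h2 := sum_norm_inner_le_traceNorm ((u n).toCLM - (u m).toCLM) W hW F
    rw [← map_sub, ENNReal.ofReal_le_iff_le_toReal (TraceClass.isTraceClass _).ne,
      ← TraceClass.norm_def, ← dist_eq_norm] at h2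
    rw [← map_sub]
    exact h2.trans (hN n hn m hm).le
  have hTt : IsTraceClass T := by
    obtain ⟨N, hN⟩ := hlim 1 one_pos
    have h1 : T = (u N).toCLM + (-1 : ℂ) • ((u N).toCLM - T) := by simp
    have h2 := hN N le_rfl
    unfold IsTraceClass
    rw [h1]
    refine (traceNorm_add_le _ _).trans_lt (ENNReal.add_lt_top.2 ⟨TraceClass.isTraceClass _, ?_⟩)
    rw [traceNorm_smul]
    exact ENNReal.mul_lt_top ENNReal.ofReal_lt_top (h2.trans_lt ENNReal.ofReal_lt_top)
  refine ⟨TraceClass.mk T hTt, Metric.tendsto_atTop.2 fun ε hε => ?_⟩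
  obtain ⟨N, hN⟩ := hlim (ε / 2) (half_pos hε)
  refine ⟨N, fun n hn => ?_⟩
  have h1 := ENNReal.toReal_mono ENNReal.ofReal_ne_top (hN n hn)
  rw [ENNReal.toReal_ofReal (half_pos hε).le] at h1
  rw [dist_eq_norm, TraceClass.norm_def, map_sub]
  exact lt_of_le_of_lt h1 (half_lt_self hε)

/-- The orthogonal projector on the line spanned by a vector (`0` if the vector vanishes). -/
def projLine (v : H) : H →L[ℂ] H := (ℂ ∙ v).starProjection

theorem isTraceClass_projLine (v : H) : IsTraceClass (projLine v) := by
  have hpos : 0 ≤ projLine v := by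
    rw [ContinuousLinearMap.nonneg_iff_isPositive]
    exact ContinuousLinearMap.IsPositive.of_isStarProjection (isStarProjection_starProjection)
  have hle : traceNorm (projLine v) ≤ ENNReal.ofReal ((‖v‖ ^ 2)⁻¹) * ENNReal.ofReal (‖v‖ ^ 2) := by
    rw [← tsum_ofReal_norm_inner_sq (onb H) v, ← ENNReal.tsum_mul_left, traceNorm,
      CFC.abs_of_nonneg _ hpos]
    refine ENNReal.tsum_le_tsum fun i => ?_
    rw [← ENNReal.ofReal_mul (by positivity)]
    refine ENNReal.ofReal_le_ofReal ((RCLike.re_le_norm _).trans ?_)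
    rw [projLine, Submodule.starProjection_singleton, inner_smul_right, norm_mul, norm_div,
      norm_inner_symm v, RCLike.norm_ofReal, abs_of_nonneg (by positivity)]
    apply le_of_eq
    ring
  exact hle.trans_lt (ENNReal.mul_lt_top ENNReal.ofReal_lt_top ENNReal.ofReal_lt_top)

end TraceClass

/-! ### Operators on `L²(ℝ)` -/

section Operators

/-- The Hilbert space `L²(ℝ)` of complex square integrable functions. -/
abbrev L2R : Type := Lp ℂ 2 (volume : Measure ℝ)

/-- The parity operator `(Π φ)(p) = φ(-p)`. -/
def parityOp : L2R →L[ℂ] L2R :=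
  (Lp.compMeasurePreservingₗᵢ ℂ (fun p : ℝ => -p)
    (Measure.measurePreserving_neg (volume : Measure ℝ))).toContinuousLinearMap

theorem quasiMeasurePreserving_const_mul {c : ℝ} (hc : 0 < c) :
    Measure.QuasiMeasurePreserving (fun x : ℝ => c * x) volume volume := by
  refine ⟨by fun_prop, ?_⟩
  rw [Real.map_volume_mul_left hc.ne']
  exact Measure.smul_absolutelyContinuous

theorem memLp_dilation {c : ℝ} (hc : 0 < c) (f : L2R) :
    MemLp (fun x => (√c : ℂ) * f (c * x)) 2 (volume : Measure ℝ) := by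
  have h : MemLp f 2 (Measure.map (fun x : ℝ => c * x) volume) := by
    rw [Real.map_volume_mul_left hc.ne']
    exact (Lp.memLp f).smul_measure ENNReal.ofReal_ne_top
  exact (h.comp_of_map (by fun_prop : AEMeasurable (fun x : ℝ => c * x) volume)).const_mul _

theorem norm_sq_L2R (f : L2R) : ‖f‖ ^ 2 = ∫ x, ‖f x‖ ^ 2 := by
  have h := congrArg RCLike.re (L2.inner_def (𝕜 := ℂ) f f)
  rw [← norm_sq_eq_re_inner] at h
  rw [h, ← integral_re (L2.integrable_inner f f)]
  refine integral_congr_ae (Eventually.of_forall fun x => ?_)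
  exact (norm_sq_eq_re_inner (𝕜 := ℂ) (f x)).symm

/-- The dilation `f ↦ √c f(c ·)` as a function on `L²(ℝ)`. -/
def dilationFun {c : ℝ} (hc : 0 < c) (f : L2R) : L2R := (memLp_dilation hc f).toLp _

theorem coeFn_dilationFun {c : ℝ} (hc : 0 < c) (f : L2R) :
    dilationFun hc f =ᵐ[volume] fun x => (√c : ℂ) * f (c * x) := MemLp.coeFn_toLp _

theorem dilationFun_inv {c d : ℝ} (hc : 0 < c) (hd : 0 < d) (hcd : c * d = 1) (f : L2R) :
    dilationFun hd (dilationFun hc f) = f := by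
  refine Lp.ext ?_
  filter_upwards [coeFn_dilationFun hd (dilationFun hc f),
    (quasiMeasurePreserving_const_mul hd).ae_eq_comp (coeFn_dilationFun hc f)] with x h1 h2
  simp only [Function.comp_apply] at h2
  rw [h1, h2, ← mul_assoc, ← mul_assoc, hcd, one_mul, ← Complex.ofReal_mul,
    ← Real.sqrt_mul hd.le, mul_comm d c, hcd]
  simp

/-- The unitary dilation `f ↦ √c f(c ·)` on `L²(ℝ)`, for `c > 0`. -/
def dilation {c : ℝ} (hc : 0 < c) : L2R ≃ₗᵢ[ℂ] L2R where
  toFun := dilationFun hc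
  invFun := dilationFun (inv_pos.2 hc)
  left_inv := dilationFun_inv hc _ (mul_inv_cancel₀ hc.ne')
  right_inv := dilationFun_inv _ hc (inv_mul_cancel₀ hc.ne')
  map_add' f g := by
    refine Lp.ext ?_
    filter_upwards [coeFn_dilationFun hc (f + g), coeFn_dilationFun hc f, coeFn_dilationFun hc g,
      (quasiMeasurePreserving_const_mul hc).ae_eq_comp (Lp.coeFn_add f g),
      Lp.coeFn_add (dilationFun hc f) (dilationFun hc g)] with x h1 h2 h3 h4 h5
    simp only [Function.comp_apply, Pi.add_apply] at h4 h5
    rw [h1, h4, h5, h2, h3, mul_add]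
  map_smul' a f := by
    refine Lp.ext ?_
    filter_upwards [coeFn_dilationFun hc (a • f), coeFn_dilationFun hc f,
      (quasiMeasurePreserving_const_mul hc).ae_eq_comp (Lp.coeFn_smul a f),
      Lp.coeFn_smul a (dilationFun hc f)] with x h1 h2 h3 h4
    simp only [Function.comp_apply, Pi.smul_apply, smul_eq_mul, RingHom.id_apply] at h3 h4 ⊢
    rw [h1, h3, h4, h2, mul_left_comm]
  norm_map' f := by
    change ‖dilationFun hc f‖ = ‖f‖
    rw [← sq_eq_sq₀ (norm_nonneg _) (norm_nonneg _), norm_sq_L2R, norm_sq_L2R]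
    have h : ∫ x, ‖dilationFun hc f x‖ ^ 2 = ∫ x, c * ‖f (c * x)‖ ^ 2 := by
      refine integral_congr_ae ?_
      filter_upwards [coeFn_dilationFun hc f] with x hx
      rw [hx, norm_mul, mul_pow, Complex.norm_real, Real.norm_of_nonneg (Real.sqrt_nonneg c),
        Real.sq_sqrt hc.le]
    rw [h, integral_const_mul, Measure.integral_comp_mul_left (fun y => ‖f y‖ ^ 2) c,
      abs_of_pos (inv_pos.2 hc), smul_eq_mul, ← mul_assoc, mul_inv_cancel₀ hc.ne', one_mul]

/-- The unitary Fourier transform `(F φ)(p) = (2π)^(-1/2) ∫ e^(-i p x) φ(x) dx` on `L²(ℝ)`, i.e.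
`(F φ)(p) = (2π)^(-1/2) (𝓕 φ)(p / 2π)` with `(𝓕 φ)(ξ) = ∫ e^(-2π i ξ x) φ(x) dx`. -/
def unitaryFourier : L2R ≃ₗᵢ[ℂ] L2R :=
  (Lp.fourierTransformₗᵢ ℝ ℂ).trans (dilation (inv_pos.2 Real.two_pi_pos))

/-! ### Integral operators -/

/-- A convenient class of Hilbert-Schmidt kernels on `ℝ`. -/
structure IsDominatedKernel (K : ℝ → ℝ → ℝ) : Prop where
  cont : Continuous fun z : ℝ × ℝ => K z.1 z.2
  bound : ∃ C : ℝ, ∀ p q, |K p q| ≤ C * (√(1 + p ^ 2))⁻¹ * (√(1 + q ^ 2))⁻¹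

theorem memLp_inv_sqrt : MemLp (fun p : ℝ => (√(1 + p ^ 2))⁻¹) 2 (volume : Measure ℝ) := by
  have hm : Continuous fun p : ℝ => (√(1 + p ^ 2))⁻¹ :=
    Continuous.inv₀ (by fun_prop) fun p => (Real.sqrt_pos.2 (by positivity)).ne'
  rw [memLp_two_iff_integrable_sq_norm hm.aestronglyMeasurable]
  refine integrable_inv_one_add_sq.congr (Eventually.of_forall fun p => ?_)
  simp only [norm_inv, Real.norm_of_nonneg (Real.sqrt_nonneg _), inv_pow]
  rw [Real.sq_sqrt (by positivity)]

theorem memLp_inv_sqrt' : MemLp (fun p : ℝ => (((√(1 + p ^ 2))⁻¹ : ℝ) : ℂ)) 2 volume :=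
  memLp_inv_sqrt.ofReal

theorem IsDominatedKernel.integrable {K : ℝ → ℝ → ℝ} (hK : IsDominatedKernel K) (φ : L2R) (p : ℝ) :
    Integrable (fun q => (K p q : ℂ) * φ q) := by
  obtain ⟨C, hC⟩ := hK.bound
  have h1 : Integrable (fun q => (((√(1 + q ^ 2))⁻¹ : ℝ) : ℂ) * φ q) :=
    MemLp.integrable_mul memLp_inv_sqrt' (Lp.memLp φ)
  have hc : Continuous fun q => (K p q : ℂ) :=
    Complex.continuous_ofReal.comp (hK.cont.comp (by fun_prop : Continuous fun q : ℝ => (p, q)))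
  refine (h1.norm.const_mul (C * (√(1 + p ^ 2))⁻¹)).mono'
    (hc.aestronglyMeasurable.mul (Lp.aestronglyMeasurable φ)) (Eventually.of_forall fun q => ?_)
  rw [norm_mul, norm_mul, Complex.norm_real, Complex.norm_real, Real.norm_eq_abs,
    Real.norm_of_nonneg (by positivity : (0 : ℝ) ≤ (√(1 + q ^ 2))⁻¹), ← mul_assoc]
  exact mul_le_mul_of_nonneg_right (hC p q) (norm_nonneg _)

theorem IsDominatedKernel.norm_integral_le {K : ℝ → ℝ → ℝ} (hK : IsDominatedKernel K) :
    ∃ C : ℝ, 0 ≤ C ∧ ∀ (φ : L2R) (p : ℝ),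
      ‖∫ q, (K p q : ℂ) * φ q‖ ≤ C * ‖φ‖ * (√(1 + p ^ 2))⁻¹ := by
  obtain ⟨C, hC⟩ := hK.bound
  have hC0 : 0 ≤ C := by
    have := (abs_nonneg _).trans (hC 0 0)
    simpa using this
  set h : L2R := memLp_inv_sqrt'.toLp _ with hh
  refine ⟨C * ‖h‖, by positivity, fun φ p => ?_⟩
  have hφ : MemLp (fun q => ((‖φ q‖ : ℝ) : ℂ)) 2 (volume : Measure ℝ) :=
    (Lp.memLp φ).norm.ofReal
  set a : L2R := hφ.toLp _ with ha
  have han : ‖a‖ = ‖φ‖ := by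
    refine le_antisymm (Lp.norm_le_norm_of_ae_le ?_) (Lp.norm_le_norm_of_ae_le ?_) <;>
    · filter_upwards [hφ.coeFn_toLp] with q hq
      rw [ha, hq]
      simp
  have hint : ∫ q, (√(1 + q ^ 2))⁻¹ * ‖φ q‖ ≤ ‖h‖ * ‖φ‖ := by
    have h1 : ((∫ q, (√(1 + q ^ 2))⁻¹ * ‖φ q‖ : ℝ) : ℂ) = ⟪h, a⟫_ℂ := by
      rw [L2.inner_def, ← integral_complex_ofReal]
      refine integral_congr_ae ?_
      filter_upwards [hφ.coeFn_toLp,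
        memLp_inv_sqrt'.coeFn_toLp] with q hq1 hq2
      rw [ha, hh, hq1, hq2]
      simp [mul_comm]
    have h2 := norm_inner_le_norm (𝕜 := ℂ) h a
    rw [← h1, Complex.norm_real, han] at h2
    exact (le_abs_self _).trans h2
  have h1 : Integrable (fun q => (√(1 + q ^ 2))⁻¹ * ‖φ q‖) :=
    MemLp.integrable_mul memLp_inv_sqrt (Lp.memLp φ).norm
  calc ‖∫ q, (K p q : ℂ) * φ q‖
      ≤ ∫ q, C * (√(1 + p ^ 2))⁻¹ * ((√(1 + q ^ 2))⁻¹ * ‖φ q‖) := by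
        refine norm_integral_le_of_norm_le (h1.const_mul _) (Eventually.of_forall fun q => ?_)
        rw [norm_mul, Complex.norm_real, Real.norm_eq_abs, ← mul_assoc]
        exact mul_le_mul_of_nonneg_right (hC p q) (norm_nonneg _)
    _ = C * (√(1 + p ^ 2))⁻¹ * ∫ q, (√(1 + q ^ 2))⁻¹ * ‖φ q‖ := integral_const_mul _ _
    _ ≤ C * (√(1 + p ^ 2))⁻¹ * (‖h‖ * ‖φ‖) := by gcongr
    _ = C * ‖h‖ * ‖φ‖ * (√(1 + p ^ 2))⁻¹ := by ring

theorem IsDominatedKernel.memLp {K : ℝ → ℝ → ℝ} (hK : IsDominatedKernel K) (φ : L2R) :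
    MemLp (fun p => ∫ q, (K p q : ℂ) * φ q) 2 (volume : Measure ℝ) := by
  obtain ⟨C, -, hC⟩ := hK.norm_integral_le
  refine (memLp_inv_sqrt.const_mul (C * ‖φ‖)).mono' ?_ (Eventually.of_forall fun p => hC φ p)
  have hm : StronglyMeasurable (fun z : ℝ × ℝ => (K z.1 z.2 : ℂ) * φ z.2) :=
    (Complex.continuous_ofReal.comp hK.cont).stronglyMeasurable.mul
      ((Lp.stronglyMeasurable φ).comp_measurable measurable_snd)
  exact hm.integral_prod_right'.aestronglyMeasurable

/-- The integral operator `(T φ)(p) = ∫ K(p, q) φ(q) dq` on `L²(ℝ)`. -/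
def integralOp {K : ℝ → ℝ → ℝ} (hK : IsDominatedKernel K) : L2R →L[ℂ] L2R :=
  LinearMap.mkContinuousOfExistsBound
    { toFun := fun φ => (hK.memLp φ).toLp (fun p => ∫ q, (K p q : ℂ) * φ q)
      map_add' := fun φ ψ => by
        rw [← MemLp.toLp_add (hK.memLp φ) (hK.memLp ψ)]
        refine MemLp.toLp_congr _ _ (Eventually.of_forall fun p => ?_)
        rw [Pi.add_apply, ← integral_add (hK.integrable φ p) (hK.integrable ψ p)]
        refine integral_congr_ae ?_
        filter_upwards [Lp.coeFn_add φ ψ] with q hq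
        rw [hq, Pi.add_apply, mul_add]
      map_smul' := fun a φ => by
        rw [RingHom.id_apply, ← MemLp.toLp_const_smul a (hK.memLp φ)]
        refine MemLp.toLp_congr _ _ (Eventually.of_forall fun p => ?_)
        rw [Pi.smul_apply, smul_eq_mul, ← integral_const_mul]
        refine integral_congr_ae ?_
        filter_upwards [Lp.coeFn_smul a φ] with q hq
        rw [hq, Pi.smul_apply, smul_eq_mul, mul_left_comm] }
    (by
      obtain ⟨C, hC0, hC⟩ := hK.norm_integral_le
      set h : L2R := memLp_inv_sqrt'.toLp _ with hh
      refine ⟨C * ‖h‖, fun φ => ?_⟩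
      have key : ‖(hK.memLp φ).toLp (fun p => ∫ q, (K p q : ℂ) * φ q)‖ ≤ (C * ‖φ‖) * ‖h‖ := by
        refine Lp.norm_le_mul_norm_of_ae_le_mul ?_
        filter_upwards [(hK.memLp φ).coeFn_toLp, memLp_inv_sqrt'.coeFn_toLp] with p h1 h2
        rw [h1, hh, h2, Complex.norm_real, Real.norm_of_nonneg (by positivity)]
        exact hC φ p
      refine key.trans (le_of_eq ?_)
      ring)

/-! ### The operators `T_θ` -/

/-- The kernel `1 / (2π |sin θ|) · 1 / ((t² - 2 cos θ t s + s²) / (2 sin² θ) + k²)`. -/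
def kernelT (θ k t s : ℝ) : ℝ :=
  1 / (2 * Real.pi * |Real.sin θ|) *
    (1 / ((t ^ 2 - 2 * Real.cos θ * t * s + s ^ 2) / (2 * Real.sin θ ^ 2) + k ^ 2))

theorem isDominatedKernel_kernelT {θ : ℝ} (hθ : θ ∈ Ioo 0 Real.pi) :
    IsDominatedKernel (kernelT θ 1) := by
  have hs : 0 < Real.sin θ := Real.sin_pos_of_mem_Ioo hθ
  have hsc := Real.sin_sq_add_cos_sq θ
  have hden : ∀ t s : ℝ, (1 - Real.cos θ ^ 2) * (1 + t ^ 2 + s ^ 2) ≤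
      2 * ((t ^ 2 - 2 * Real.cos θ * t * s + s ^ 2) + 2 * Real.sin θ ^ 2) := by
    intro t s
    nlinarith [sq_nonneg (t - Real.cos θ * s), sq_nonneg (s - Real.cos θ * t), sq_nonneg t,
      sq_nonneg s]
  have hs2 : 1 - Real.cos θ ^ 2 = Real.sin θ ^ 2 := by linarith
  rw [hs2] at hden
  have hpos : ∀ t s : ℝ, 0 < (t ^ 2 - 2 * Real.cos θ * t * s + s ^ 2) + 2 * Real.sin θ ^ 2 :=
    fun t s => by
      have := hden t s
      have : 0 < Real.sin θ ^ 2 * (1 + t ^ 2 + s ^ 2) := by positivity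
      linarith
  have hker : ∀ t s : ℝ, kernelT θ 1 t s = Real.sin θ / Real.pi *
      ((t ^ 2 - 2 * Real.cos θ * t * s + s ^ 2) + 2 * Real.sin θ ^ 2)⁻¹ := by
    intro t s
    have h1 := (hpos t s).ne'
    have h2 : (t ^ 2 - 2 * Real.cos θ * t * s + s ^ 2) / (2 * Real.sin θ ^ 2) + 1 ^ 2 =
        ((t ^ 2 - 2 * Real.cos θ * t * s + s ^ 2) + 2 * Real.sin θ ^ 2) /
          (2 * Real.sin θ ^ 2) := by
      field_simp
    rw [kernelT, abs_of_pos hs, h2, one_div_div]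
    have := Real.pi_pos.ne'
    generalize (t ^ 2 - 2 * Real.cos θ * t * s + s ^ 2) + 2 * Real.sin θ ^ 2 = D at *
    field_simp
  refine ⟨?_, Real.sin θ / Real.pi * (2 / Real.sin θ ^ 2), fun t s => ?_⟩
  · simp_rw [hker]
    exact continuous_const.mul (Continuous.inv₀ (by fun_prop) fun z => (hpos z.1 z.2).ne')
  · have h0 : 0 ≤ Real.sin θ / Real.pi := div_nonneg hs.le Real.pi_pos.le
    rw [hker, abs_of_nonneg (mul_nonneg h0 (inv_pos.2 (hpos t s)).le), mul_assoc _ _ (√(1 + s ^ 2))⁻¹,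
      mul_assoc (Real.sin θ / Real.pi)]
    refine mul_le_mul_of_nonneg_left ?_ h0
    have h1 : √(1 + t ^ 2) * √(1 + s ^ 2) ≤ 1 + t ^ 2 + s ^ 2 := by
      rw [← Real.sqrt_mul (by positivity)]
      refine Real.sqrt_le_iff.2 ⟨by positivity, ?_⟩
      nlinarith [sq_nonneg t, sq_nonneg s, mul_nonneg (sq_nonneg t) (sq_nonneg s)]
    have h2 : 0 < √(1 + t ^ 2) * √(1 + s ^ 2) := by positivity
    rw [← mul_inv, ← div_eq_mul_inv, inv_le_comm₀ (hpos t s) (by positivity), inv_div]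
    rw [div_div_eq_mul_div, div_le_iff₀ two_pos]
    have h3 := hden t s
    have h4 : √(1 + t ^ 2) * √(1 + s ^ 2) * Real.sin θ ^ 2 ≤
        (1 + t ^ 2 + s ^ 2) * Real.sin θ ^ 2 := by gcongr
    linarith

/-- The operator `T̂_θ` on `L²(ℝ)` (in the Fourier representation, at `k = 1`). -/
def hatT {θ : ℝ} (hθ : θ ∈ Ioo 0 Real.pi) : L2R →L[ℂ] L2R :=
  integralOp (isDominatedKernel_kernelT hθ)

/-- The even part `T̂_θ⁺ = (1 + Π)/2 T̂_θ`. -/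
def hatTPlus {θ : ℝ} (hθ : θ ∈ Ioo 0 Real.pi) : L2R →L[ℂ] L2R :=
  ((1 / 2 : ℂ) • (1 + parityOp)) ∘L hatT hθ

/-- The odd part `T̂_θ⁻ = (1 - Π)/2 T̂_θ`. -/
def hatTMinus {θ : ℝ} (hθ : θ ∈ Ioo 0 Real.pi) : L2R →L[ℂ] L2R :=
  ((1 / 2 : ℂ) • (1 - parityOp)) ∘L hatT hθ

/-- The operator `F⁻¹ A F` whose Fourier transform is `A`. -/
def fourierConj (A : L2R →L[ℂ] L2R) : L2R →L[ℂ] L2R :=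
  (unitaryFourier.symm.toContinuousLinearEquiv : L2R →L[ℂ] L2R) ∘L A ∘L
    (unitaryFourier.toContinuousLinearEquiv : L2R →L[ℂ] L2R)

/-- The operator `T_θ` (in the position representation). -/
def opT {θ : ℝ} (hθ : θ ∈ Ioo 0 Real.pi) : L2R →L[ℂ] L2R := fourierConj (hatT hθ)

/-- The operator `T_θ⁺` (in the position representation). -/
def opTPlus {θ : ℝ} (hθ : θ ∈ Ioo 0 Real.pi) : L2R →L[ℂ] L2R := fourierConj (hatTPlus hθ)

/-- The operator `T_θ⁻` (in the position representation). -/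
def opTMinus {θ : ℝ} (hθ : θ ∈ Ioo 0 Real.pi) : L2R →L[ℂ] L2R := fourierConj (hatTMinus hθ)

/-! ### The rank one projectors -/

/-- The function `g_{n,s}(p) = ((2s)^(n+1/2) / Γ(n+1/2))^(1/2) p^n e^(-p² s)`. -/
def gFun (n : ℕ) (s p : ℝ) : ℝ :=
  √((2 * s) ^ ((n : ℝ) + 1 / 2) / Real.Gamma ((n : ℝ) + 1 / 2)) * p ^ n * Real.exp (-p ^ 2 * s)

theorem memLp_gFun (n : ℕ) {s : ℝ} (hs : 0 < s) :
    MemLp (fun p => (gFun n s p : ℂ)) 2 (volume : Measure ℝ) := by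
  have hc : Continuous (gFun n s) := by unfold gFun; fun_prop
  suffices h : MemLp (gFun n s) 2 (volume : Measure ℝ) from h.ofReal
  rw [memLp_two_iff_integrable_sq hc.aestronglyMeasurable]
  have h := integrable_rpow_mul_exp_neg_mul_sq (b := 2 * s) (by positivity) (s := ((2 * n : ℕ) : ℝ))
    (by have : (0 : ℝ) ≤ ((2 * n : ℕ) : ℝ) := by positivity
        linarith)
  refine (h.const_mul
    (√((2 * s) ^ ((n : ℝ) + 1 / 2) / Real.Gamma ((n : ℝ) + 1 / 2)) ^ 2)).congr
    (Eventually.of_forall fun p => ?_)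
  simp only [gFun, Real.rpow_natCast]
  rw [mul_pow, mul_pow, ← Real.exp_nat_mul, ← pow_mul, mul_comm n 2, ← mul_assoc]
  congr 2
  push_cast
  ring

open Classical in
/-- The function `g_{n,s}` as a vector of `L²(ℝ)`; it is meant for `s > 0`, where it always is
square integrable (for other `s` the value `0` is used if it is not). -/
def gVec (n : ℕ) (s : ℝ) : L2R :=
  if h : MemLp (fun p => (gFun n s p : ℂ)) 2 (volume : Measure ℝ) then h.toLp _ else 0

/-- The orthogonal projector `P_{n,s}` on (the line spanned by) `g_{n,s}`, as a trace class
operator. -/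
def projG (n : ℕ) (s : ℝ) : TraceClass L2R :=
  TraceClass.mk (projLine (gVec n s)) (isTraceClass_projLine (gVec n s))

/-- The trace class operator valued function `s ↦ s^(-1/2) e^(-2 sin² θ s) P_{n,s}`. -/
def projIntegrand (θ : ℝ) (n : ℕ) (s : ℝ) : TraceClass L2R :=
  (s ^ (-(1 / 2) : ℝ) * Real.exp (-2 * Real.sin θ ^ 2 * s)) • projG n s

end Operators

end

/-! With `D = p² + q² + 2 sin² θ` the kernel is `(sin θ / π) / (D - 2 cos θ p q)`. Since `2|pq| ≤ D`
and `|cos θ| < 1`, it expands in a geometric series with terms `cosⁿ θ (2pq)ⁿ / D^(n+1)`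
(`hasSum_kernelTerm`). Writing `1 / D^(n+1)` as `1/n!` times the integral of `sⁿ e^(-Ds)` over `s >
0` separates the variables: the integrand is a constant times `s^(-1/2) e^(-2 sin² θ s) g_{n,s}(p)
g_{n,s}(q)` (`weight_mul_gFun_mul_gFun`), the kernel of a weighted rank one projector.

The series of Bochner integrals converges absolutely in trace norm: the integrals are bounded
uniformly in `n`, and the coefficients are those of the binomial series of `(1 - x)^(-1/2)` at `x =
cos θ`, up to a constant factor. Its sum is identified with `T̂_θ` through matrix elements `⟪ψ, ·
φ⟫`, which are continuous on the trace class and turn everything into scalar Fubini arguments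
(`inner_integral_projIntegrand`, `toCLM_tsum_decompTerm`).

As `g_{n,s}` has parity `(-1)ⁿ`, the even and odd terms sum to `T̂_θ⁺` and `T̂_θ⁻`; the sign of
`cosⁿ θ` gives their signs (`nonneg_of_hasSum`). Every projector has trace one, so the traces are
the even and odd parts of the binomial series, evaluated at `± cos θ` (`trace_tsum_even_and_odd`).
For a positive operator the trace norm is the trace; when `θ ≥ π/2` this is applied to `-T̂_θ⁻` and
to `Π T̂_θ = T̂_θ⁺ - T̂_θ⁻`, which has the trace norm of `T̂_θ` because `Π` is isometric. -/

noncomputable section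

/-! ### The trace as a functional, rank one operators and unitary invariance. -/

section TraceFunctional

universe u

variable {H : Type u} [NormedAddCommGroup H] [InnerProductSpace ℂ H]

theorem projLine_eq_rankOne {v : H} (hv : ‖v‖ = 1) :
    projLine v = InnerProductSpace.rankOne ℂ v v := by
  ext w
  rw [projLine, Submodule.starProjection_unit_singleton ℂ hv, InnerProductSpace.rankOne_apply]

theorem HasTrace.add {S T : H →L[ℂ] H} {σ τ : ℂ} (hS : HasTrace S σ) (hT : HasTrace T τ) :
    HasTrace (S + T) (σ + τ) := fun ι b => by
  simpa [inner_add_right] using (hS ι b).add (hT ι b)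

theorem HasTrace.neg {T : H →L[ℂ] H} {τ : ℂ} (hT : HasTrace T τ) : HasTrace (-T) (-τ) :=
  fun ι b => by simpa using (hT ι b).neg

/-- The image of a Hilbert basis under a unitary operator. -/
def HilbertBasis.mapEquiv {ι : Type*} (b : HilbertBasis ι ℂ H) (U : H ≃ₗᵢ[ℂ] H) :
    HilbertBasis ι ℂ H :=
  HilbertBasis.ofRepr (U.symm.trans b.repr)

theorem HilbertBasis.mapEquiv_apply {ι : Type*} (b : HilbertBasis ι ℂ H) (U : H ≃ₗᵢ[ℂ] H) (i : ι) :
    b.mapEquiv U i = U (b i) := by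
  classical
  rw [← HilbertBasis.repr_symm_single, ← HilbertBasis.repr_symm_single b]
  rfl

variable [CompleteSpace H]

/-- The diagonal sums in the variational formula are sums of products of coefficients of `star W u`
and of `v`; Cauchy-Schwarz and Bessel bound them. -/
theorem traceNorm_rankOne_le (u v : H) :
    traceNorm (InnerProductSpace.rankOne ℂ u v) ≤ ENNReal.ofReal (‖u‖ * ‖v‖) := by
  refine traceNorm_le_of_forall _ _ fun W hW F => ENNReal.ofReal_le_ofReal ?_
  have h1 : ∑ i ∈ F, ‖⟪onb H i, star W u⟫_ℂ‖ ^ 2 ≤ ‖star W u‖ ^ 2 :=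
    (onb H).orthonormal.sum_inner_products_le _
  have h2 : ∑ i ∈ F, ‖⟪onb H i, v⟫_ℂ‖ ^ 2 ≤ ‖v‖ ^ 2 := (onb H).orthonormal.sum_inner_products_le _
  have h3 : ‖star W u‖ ≤ ‖u‖ := by
    have := (star W).le_of_opNorm_le (by rwa [norm_star] : ‖star W‖ ≤ 1) u
    rwa [one_mul] at this
  calc ∑ i ∈ F, ‖⟪W (onb H i), InnerProductSpace.rankOne ℂ u v (onb H i)⟫_ℂ‖
      = ∑ i ∈ F, ‖⟪onb H i, star W u⟫_ℂ‖ * ‖⟪onb H i, v⟫_ℂ‖ := by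
        refine Finset.sum_congr rfl fun i _ => ?_
        rw [InnerProductSpace.rankOne_apply, inner_smul_right, norm_mul, mul_comm,
          norm_inner_symm v, ContinuousLinearMap.star_eq_adjoint,
          ContinuousLinearMap.adjoint_inner_right]
    _ ≤ √(∑ i ∈ F, ‖⟪onb H i, star W u⟫_ℂ‖ ^ 2) * √(∑ i ∈ F, ‖⟪onb H i, v⟫_ℂ‖ ^ 2) :=
        Real.sum_mul_le_sqrt_mul_sqrt _ _ _
    _ ≤ ‖star W u‖ * ‖v‖ := mul_le_mul (Real.sqrt_le_iff.2 ⟨norm_nonneg _, h1⟩)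
        (Real.sqrt_le_iff.2 ⟨norm_nonneg _, h2⟩) (Real.sqrt_nonneg _) (norm_nonneg _)
    _ ≤ ‖u‖ * ‖v‖ := by gcongr

/-- The rank one operator `x ↦ ⟪v, x⟫ u` as a trace class operator. -/
def TraceClass.rankOne (u v : H) : TraceClass H :=
  TraceClass.mk (InnerProductSpace.rankOne ℂ u v)
    ((traceNorm_rankOne_le u v).trans_lt ENNReal.ofReal_lt_top)

theorem TraceClass.toCLM_rankOne (u v : H) :
    (TraceClass.rankOne u v).toCLM = InnerProductSpace.rankOne ℂ u v := rfl

theorem TraceClass.norm_rankOne_le (u v : H) : ‖TraceClass.rankOne u v‖ ≤ ‖u‖ * ‖v‖ := by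
  rw [TraceClass.norm_def, TraceClass.toCLM_rankOne]
  have := ENNReal.toReal_mono ENNReal.ofReal_ne_top (traceNorm_rankOne_le u v)
  rwa [ENNReal.toReal_ofReal (by positivity)] at this

/-- Makes `s ↦ P_{n,s}` continuous in trace norm, hence strongly measurable as Bochner integrability
requires. The difference of two values is split as for any quadratic map. -/
theorem TraceClass.continuous_rankOne_self :
    Continuous fun v : H => TraceClass.rankOne v v := by
  have hdiff : ∀ v w : H, TraceClass.rankOne w w - TraceClass.rankOne v v =
      TraceClass.rankOne (w - v) w + TraceClass.rankOne v (w - v) := fun v w =>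
    TraceClass.toCLM_injective (by simp [TraceClass.toCLM_rankOne])
  refine continuous_iff_continuousAt.2 fun v => tendsto_iff_norm_sub_tendsto_zero.2 ?_
  have hlim : Tendsto (fun w : H => ‖w - v‖ * ‖w‖ + ‖v‖ * ‖w - v‖) (𝓝 v) (𝓝 0) := by
    have : Continuous fun w : H => ‖w - v‖ * ‖w‖ + ‖v‖ * ‖w - v‖ := by fun_prop
    simpa using this.tendsto v
  refine squeeze_zero (fun _ => norm_nonneg _) (fun w => ?_) hlim
  rw [hdiff]
  exact (norm_add_le _ _).trans
    (add_le_add (TraceClass.norm_rankOne_le _ _) (TraceClass.norm_rankOne_le _ _))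

/-- The inclusion of the trace class operators into the bounded operators, as a continuous linear
map. -/
def TraceClass.toCLML : TraceClass H →L[ℂ] (H →L[ℂ] H) :=
  TraceClass.toCLM.mkContinuous 1 fun T => by rw [one_mul]; exact T.opNorm_le

/-- The variational bound at `W = 1`; it makes the trace a functional of norm at most one. -/
theorem TraceClass.sum_norm_inner_le (T : TraceClass H) (F : Finset (onbIndex H)) :
    ∑ i ∈ F, ‖⟪onb H i, T.toCLM (onb H i)⟫_ℂ‖ ≤ ‖T‖ := by
  have h := sum_norm_inner_le_traceNorm T.toCLM 1 ContinuousLinearMap.norm_id_le F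
  rwa [ENNReal.ofReal_le_iff_le_toReal T.isTraceClass.ne] at h

theorem TraceClass.summable_norm_inner (T : TraceClass H) :
    Summable fun i => ‖⟪onb H i, T.toCLM (onb H i)⟫_ℂ‖ :=
  summable_of_sum_le (fun _ => norm_nonneg _) T.sum_norm_inner_le

/-- The trace, as a continuous linear functional on the trace class operators. -/
def TraceClass.trace : TraceClass H →L[ℂ] ℂ :=
  LinearMap.mkContinuous
    { toFun := fun T => ∑' i, ⟪onb H i, T.toCLM (onb H i)⟫_ℂ
      map_add' := fun S T => by
        rw [← S.summable_norm_inner.of_norm.tsum_add T.summable_norm_inner.of_norm]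
        simp
      map_smul' := fun c T => by
        rw [RingHom.id_apply, smul_eq_mul, ← tsum_mul_left]
        simp }
    1 fun T => by
      rw [one_mul]
      exact (norm_tsum_le_tsum_norm T.summable_norm_inner).trans
        (Real.tsum_le_of_sum_le (fun _ => norm_nonneg _) T.sum_norm_inner_le)

theorem TraceClass.trace_apply (T : TraceClass H) :
    TraceClass.trace T = ∑' i, ⟪onb H i, T.toCLM (onb H i)⟫_ℂ := rfl

theorem TraceClass.hasSum_trace (T : TraceClass H) :
    HasSum (fun i => ⟪onb H i, T.toCLM (onb H i)⟫_ℂ) (TraceClass.trace T) :=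
  T.summable_norm_inner.of_norm.hasSum

theorem TraceClass.trace_rankOne (u v : H) : TraceClass.trace (TraceClass.rankOne u v) = ⟪v, u⟫_ℂ := by
  rw [TraceClass.trace_apply, ← (onb H).tsum_inner_mul_inner v u]
  simp [TraceClass.toCLM_rankOne]

/-- Independence of the basis. With `R` the square root of `T`, each term is `‖R (b i)‖²`; expand it
in `onb H`, interchange the sums of nonnegative terms, move the self-adjoint `R` across and sum over
`b`. -/
theorem tsum_ofReal_inner_of_nonneg {T : H →L[ℂ] H} (hT : 0 ≤ T) {ι : Type*}
    (b : HilbertBasis ι ℂ H) :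
    ∑' i, ENNReal.ofReal (RCLike.re ⟪b i, T (b i)⟫_ℂ) = traceNorm T := by
  have hre := re_inner_abs T
  rw [CFC.abs_of_nonneg T hT] at hre
  rw [traceNorm_eq_hsSq, CFC.abs_of_nonneg T hT, hsSq]
  set R := CFC.sqrt T
  have hR : star R = R := (CFC.sqrt_nonneg T).isSelfAdjoint
  simp_rw [hre]
  calc ∑' i, ENNReal.ofReal (‖R (b i)‖ ^ 2)
      = ∑' i, ∑' j, ENNReal.ofReal (‖⟪onb H j, R (b i)⟫_ℂ‖ ^ 2) := by
        simp_rw [tsum_ofReal_norm_inner_sq]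
    _ = ∑' j, ∑' i, ENNReal.ofReal (‖⟪onb H j, R (b i)⟫_ℂ‖ ^ 2) := ENNReal.tsum_comm
    _ = ∑' j, ∑' i, ENNReal.ofReal (‖⟪b i, R (onb H j)⟫_ℂ‖ ^ 2) := by
        congr! 5 with j i
        conv_lhs => rw [← hR]
        rw [ContinuousLinearMap.star_eq_adjoint, ContinuousLinearMap.adjoint_inner_right,
          norm_inner_symm]
    _ = _ := by simp_rw [tsum_ofReal_norm_inner_sq]

/-- `HasTrace` speaks of all bases while `TraceClass.trace` is computed in the single basis `onb H`.
Positivity bridges the two, and operators without a sign are later reached by addition and negation.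
-/
theorem HasTrace.of_nonneg {T : H →L[ℂ] H} (hT : 0 ≤ T) (htr : IsTraceClass T) :
    HasTrace T ((traceNorm T).toReal : ℂ) := by
  intro ι b
  have hpos := (ContinuousLinearMap.nonneg_iff_isPositive T).1 hT
  have h0 : ∀ i, 0 ≤ RCLike.re ⟪b i, T (b i)⟫_ℂ := fun i => hpos.re_inner_nonneg_right (b i)
  have hterm : ∀ i, ⟪b i, T (b i)⟫_ℂ = ((RCLike.re ⟪b i, T (b i)⟫_ℂ : ℝ) : ℂ) := fun i =>
    Complex.ext rfl (RCLike.nonneg_iff.1 (hpos.inner_nonneg_right (b i))).2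
  have h := tsum_ofReal_inner_of_nonneg hT b
  have hs := ENNReal.hasSum_toReal (f := fun i => ENNReal.ofReal (RCLike.re ⟪b i, T (b i)⟫_ℂ))
    (by rw [h]; exact htr.ne)
  rw [← ENNReal.tsum_toReal_eq fun i => ENNReal.ofReal_ne_top, h] at hs
  simp_rw [ENNReal.toReal_ofReal (h0 _)] at hs
  rw [funext hterm]
  exact Complex.hasSum_ofReal.2 hs

theorem TraceClass.traceNorm_of_nonneg {T : TraceClass H} (hT : 0 ≤ T.toCLM) {τ : ℝ}
    (hτ : TraceClass.trace T = τ) : traceNorm T.toCLM = ENNReal.ofReal τ := by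
  have h := HasTrace.of_nonneg hT T.isTraceClass _ (onb H)
  have h2 := h.unique T.hasSum_trace
  rw [hτ] at h2
  rw [← Complex.ofReal_inj.1 h2, ENNReal.ofReal_toReal T.isTraceClass.ne]

theorem traceNorm_neg (T : H →L[ℂ] H) : traceNorm (-T) = traceNorm T := by
  simp [traceNorm, CFC.abs_neg]

/-- The modulus depends only on `star T * T`, which an isometric left factor leaves unchanged. -/
theorem traceNorm_mul_left_of_isometry {U : H →L[ℂ] H} (hU : star U * U = 1) (T : H →L[ℂ] H) :
    traceNorm (U * T) = traceNorm T := by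
  have h : star (U * T) * (U * T) = star T * T := by
    rw [star_mul, mul_assoc, ← mul_assoc (star U), hU, one_mul]
  rw [traceNorm, CFC.abs, h]
  rfl

theorem nonneg_conjStarAlgEquiv (U : H ≃ₗᵢ[ℂ] H) {T : H →L[ℂ] H} (hT : 0 ≤ T) :
    0 ≤ U.conjStarAlgEquiv T := by
  have h : T = star (CFC.sqrt T) * CFC.sqrt T := by
    rw [(CFC.sqrt_nonneg T).isSelfAdjoint.star_eq, CFC.sqrt_mul_sqrt_self T hT]
  rw [h, map_mul, map_star]
  exact star_mul_self_nonneg _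

theorem inner_conjStarAlgEquiv (U : H ≃ₗᵢ[ℂ] H) (T : H →L[ℂ] H) (x : H) :
    ⟪x, U.conjStarAlgEquiv T x⟫_ℂ = ⟪U.symm x, T (U.symm x)⟫_ℂ := by
  rw [LinearIsometryEquiv.conjStarAlgEquiv_apply_apply, ← U.symm.inner_map_map,
    U.symm_apply_apply]

theorem HasTrace.conj {T : H →L[ℂ] H} {τ : ℂ} (hT : HasTrace T τ) (U : H ≃ₗᵢ[ℂ] H) :
    HasTrace (U.conjStarAlgEquiv T) τ := fun ι b => by
  simp_rw [inner_conjStarAlgEquiv, ← HilbertBasis.mapEquiv_apply]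
  exact hT ι _

/-- Conjugation is a star isomorphism preserving positivity, so it commutes with the modulus by
uniqueness of the nonnegative square root. It then amounts to a change of basis, which does not
affect the trace of the positive operator `|T|`. -/
theorem traceNorm_conj (U : H ≃ₗᵢ[ℂ] H) (T : H →L[ℂ] H) :
    traceNorm (U.conjStarAlgEquiv T) = traceNorm T := by
  have habs : CFC.abs (U.conjStarAlgEquiv T) = U.conjStarAlgEquiv (CFC.abs T) := by
    rw [CFC.abs]
    refine CFC.sqrt_unique ?_ (nonneg_conjStarAlgEquiv U (CFC.abs_nonneg T))
    rw [← map_mul, CFC.abs_mul_abs, map_mul, map_star]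
  have h2 : CFC.abs (CFC.abs T) = CFC.abs T := CFC.abs_of_nonneg _ (CFC.abs_nonneg T)
  rw [traceNorm, habs]
  simp_rw [inner_conjStarAlgEquiv, ← HilbertBasis.mapEquiv_apply]
  rw [tsum_ofReal_inner_of_nonneg (CFC.abs_nonneg T), traceNorm, h2, traceNorm]

end TraceFunctional

/-! ### The vectors `g_{n,s}`, the Bochner integrals of their projectors and the binomial series. -/

section GaussianVectors

theorem integral_pow_mul_exp_neg_mul_sq (n : ℕ) {b : ℝ} (hb : 0 < b) :
    ∫ p : ℝ, p ^ (2 * n) * Real.exp (-b * p ^ 2) =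
      Real.Gamma (n + 1 / 2) * b ^ (-((n : ℝ) + 1 / 2)) := by
  have h1 := integral_rpow_mul_exp_neg_mul_rpow (p := 2) (q := ((2 * n : ℕ) : ℝ)) two_pos
    (by have : (0 : ℝ) ≤ ((2 * n : ℕ) : ℝ) := by positivity
        linarith) hb
  have h2 := integral_comp_abs (f := fun p : ℝ => p ^ (2 * n) * Real.exp (-b * p ^ 2))
  simp only [sq_abs, (even_two_mul n).pow_abs] at h2
  have h3 : ∫ x in Ioi (0 : ℝ), x ^ (2 * n) * Real.exp (-b * x ^ 2) =
      ∫ x in Ioi (0 : ℝ), x ^ ((2 * n : ℕ) : ℝ) * Real.exp (-b * x ^ (2 : ℝ)) := by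
    refine setIntegral_congr_fun measurableSet_Ioi fun x _ => ?_
    simp only [Real.rpow_natCast, Real.rpow_two]
  have h4 : (((2 * n : ℕ) : ℝ) + 1) / 2 = n + 1 / 2 := by push_cast; ring
  have h5 : -(((2 * n : ℕ) : ℝ) + 1) / 2 = -((n : ℝ) + 1 / 2) := by push_cast; ring
  rw [h2, h3, h1, h4, h5]
  ring

theorem coeFn_gVec (n : ℕ) {s : ℝ} (hs : 0 < s) :
    gVec n s =ᵐ[volume] fun p => (gFun n s p : ℂ) := by
  rw [gVec, dif_pos (memLp_gFun n hs)]
  exact MemLp.coeFn_toLp _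

/-- The normalization constant of `g_{n,s}`. -/
def gConst (n : ℕ) (s : ℝ) : ℝ := √((2 * s) ^ ((n : ℝ) + 1 / 2) / Real.Gamma ((n : ℝ) + 1 / 2))

theorem gFun_eq (n : ℕ) (s p : ℝ) : gFun n s p = gConst n s * p ^ n * Real.exp (-p ^ 2 * s) := rfl

theorem gamma_add_half_pos (n : ℕ) : 0 < Real.Gamma ((n : ℝ) + 1 / 2) :=
  Real.Gamma_pos_of_pos (by positivity)

theorem gConst_sq (n : ℕ) {s : ℝ} (hs : 0 < s) :
    gConst n s ^ 2 = (2 * s) ^ ((n : ℝ) + 1 / 2) / Real.Gamma ((n : ℝ) + 1 / 2) :=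
  Real.sq_sqrt (div_nonneg (by positivity) (gamma_add_half_pos n).le)

theorem continuous_gConst (n : ℕ) : Continuous (gConst n) := by
  unfold gConst
  refine Continuous.sqrt (Continuous.div_const ?_ _)
  exact (by fun_prop : Continuous fun s : ℝ => 2 * s).rpow_const fun _ => Or.inr (by positivity)

/-- The product of the two Gaussians is a Gaussian of parameter `s + t`, so this is one Gamma
integral. The case `s = t` gives the normalization, the general case the continuity in `s`. -/
theorem inner_gVec (n : ℕ) {s t : ℝ} (hs : 0 < s) (ht : 0 < t) :
    ⟪gVec n s, gVec n t⟫_ℂ = ((gConst n s * gConst n t *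
      (Real.Gamma (n + 1 / 2) * (s + t) ^ (-((n : ℝ) + 1 / 2))) : ℝ) : ℂ) := by
  rw [← integral_pow_mul_exp_neg_mul_sq n (add_pos hs ht), ← integral_const_mul,
    ← integral_complex_ofReal, L2.inner_def]
  refine integral_congr_ae ?_
  filter_upwards [coeFn_gVec n hs, coeFn_gVec n ht] with p h1 h2
  rw [h1, h2, RCLike.inner_apply, Complex.conj_ofReal, ← Complex.ofReal_mul, gFun_eq, gFun_eq]
  congr 1
  have h3 : Real.exp (-(s + t) * p ^ 2) = Real.exp (-p ^ 2 * s) * Real.exp (-p ^ 2 * t) := by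
    rw [← Real.exp_add]; ring_nf
  rw [h3]
  ring

theorem norm_gVec (n : ℕ) {s : ℝ} (hs : 0 < s) : ‖gVec n s‖ = 1 := by
  have h1 := (gamma_add_half_pos n).ne'
  have h2 : (2 * s) ^ ((n : ℝ) + 1 / 2) ≠ 0 := by positivity
  have h3 : ‖gVec n s‖ ^ 2 = 1 := by
    rw [norm_sq_eq_re_inner (𝕜 := ℂ), inner_gVec n hs hs, RCLike.re_eq_complex_re,
      Complex.ofReal_re, ← two_mul, ← sq, gConst_sq n hs, Real.rpow_neg (by positivity)]
    field_simp
  exact (pow_eq_one_iff_of_nonneg (norm_nonneg _) two_ne_zero).1 h3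

/-- For unit vectors with real inner product `h t`, the squared distance is `2 - 2 h t`, and `h` is
explicit and continuous. -/
theorem continuousOn_gVec (n : ℕ) : ContinuousOn (gVec n) (Ioi 0) := by
  refine continuousOn_of_forall_continuousAt fun s (hs : 0 < s) => ?_
  set h : ℝ → ℝ := fun t => gConst n s * gConst n t *
    (Real.Gamma (n + 1 / 2) * (s + t) ^ (-((n : ℝ) + 1 / 2))) with hh
  have hnorm : ∀ t, 0 < t → ‖gVec n t - gVec n s‖ = √(2 - 2 * h t) := fun t ht => by
    have h1 := norm_sub_sq (𝕜 := ℂ) (gVec n s) (gVec n t)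
    rw [norm_gVec n hs, norm_gVec n ht, inner_gVec n hs ht, RCLike.re_eq_complex_re,
      Complex.ofReal_re] at h1
    rw [norm_sub_rev, ← Real.sqrt_sq (norm_nonneg (gVec n s - gVec n t)), h1]
    congr 1
    ring
  have hcont : ContinuousAt (fun t => √(2 - 2 * h t)) s := by
    refine (continuousAt_const.sub (continuousAt_const.mul ?_)).sqrt
    refine (continuousAt_const.mul (continuous_gConst n).continuousAt).mul
      (continuousAt_const.mul ?_)
    exact (continuousAt_const.add continuousAt_id).rpow_const (Or.inl (add_pos hs hs).ne')
  have hlim : Tendsto (fun t => √(2 - 2 * h t)) (𝓝 s) (𝓝 0) := by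
    -- The value of the limit comes from `hnorm` at `t = s`, where the distance is zero, without
    -- computing `h s`.
    have h0 := hnorm s hs
    rw [sub_self, norm_zero] at h0
    rw [h0]
    exact hcont
  refine tendsto_iff_norm_sub_tendsto_zero.2 (hlim.congr' ?_)
  filter_upwards [Ioi_mem_nhds hs] with t ht using (hnorm t ht).symm

theorem projG_eq_rankOne (n : ℕ) {s : ℝ} (hs : 0 < s) :
    projG n s = TraceClass.rankOne (gVec n s) (gVec n s) :=
  TraceClass.toCLM_injective (projLine_eq_rankOne (norm_gVec n hs))

theorem norm_projG_le (n : ℕ) {s : ℝ} (hs : 0 < s) : ‖projG n s‖ ≤ 1 := by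
  rw [projG_eq_rankOne n hs]
  refine (TraceClass.norm_rankOne_le _ _).trans ?_
  rw [norm_gVec n hs, one_mul]

theorem continuousOn_projG (n : ℕ) : ContinuousOn (projG n) (Ioi 0) :=
  (TraceClass.continuous_rankOne_self.comp_continuousOn (continuousOn_gVec n)).congr
    fun _ hs => projG_eq_rankOne n hs

/-- The weight `s^(-1/2) e^(-2 sin² θ s)`. -/
def weight (θ s : ℝ) : ℝ := s ^ (-(1 / 2) : ℝ) * Real.exp (-2 * Real.sin θ ^ 2 * s)

theorem projIntegrand_eq (θ : ℝ) (n : ℕ) (s : ℝ) :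
    projIntegrand θ n s = weight θ s • projG n s := rfl

theorem weight_nonneg (θ : ℝ) {s : ℝ} (hs : 0 < s) : 0 ≤ weight θ s := by
  unfold weight; positivity

theorem continuousOn_weight (θ : ℝ) : ContinuousOn (weight θ) (Ioi 0) := by
  unfold weight
  refine ContinuousOn.mul (fun s hs => ?_) (by fun_prop)
  exact (Real.continuousAt_rpow_const _ _ (Or.inl (ne_of_gt hs))).continuousWithinAt

theorem integrableOn_rpow_mul_exp_neg_mul {a r : ℝ} (ha : -1 < a) (hr : 0 < r) :
    IntegrableOn (fun s : ℝ => s ^ a * Real.exp (-r * s)) (Ioi 0) := by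
  simpa using integrableOn_rpow_mul_exp_neg_mul_rpow ha one_pos hr

theorem integral_rpow_mul_exp_neg_mul {a r : ℝ} (ha : 0 < a) (hr : 0 < r) :
    ∫ s in Ioi (0 : ℝ), s ^ (a - 1) * Real.exp (-r * s) = Real.Gamma a / r ^ a := by
  simp_rw [neg_mul]
  rw [Real.integral_rpow_mul_exp_neg_mul_Ioi ha hr, one_div, Real.inv_rpow hr.le]
  field_simp

theorem integrableOn_weight {θ : ℝ} (hθ : θ ∈ Ioo 0 Real.pi) :
    IntegrableOn (weight θ) (Ioi 0) := by
  have hs := Real.sin_pos_of_mem_Ioo hθ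
  refine (integrableOn_rpow_mul_exp_neg_mul (a := -(1 / 2)) (r := 2 * Real.sin θ ^ 2) (by norm_num)
    (by positivity)).congr_fun (fun s _ => ?_) measurableSet_Ioi
  simp only [weight, neg_mul]

theorem integral_weight {θ : ℝ} (hθ : θ ∈ Ioo 0 Real.pi) :
    ∫ s in Ioi (0 : ℝ), weight θ s = √Real.pi / (√2 * Real.sin θ) := by
  have hs := Real.sin_pos_of_mem_Ioo hθ
  have h := integral_rpow_mul_exp_neg_mul (a := 1 / 2) (r := 2 * Real.sin θ ^ 2) (by norm_num)
    (by positivity)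
  rw [Real.Gamma_one_half_eq, ← Real.sqrt_eq_rpow, Real.sqrt_mul two_pos.le,
    Real.sqrt_sq hs.le] at h
  rw [← h]
  refine setIntegral_congr_fun measurableSet_Ioi fun s _ => ?_
  simp only [weight, neg_mul]
  norm_num

theorem norm_projIntegrand_le (θ : ℝ) (n : ℕ) {s : ℝ} (hs : 0 < s) :
    ‖projIntegrand θ n s‖ ≤ weight θ s := by
  rw [projIntegrand_eq, norm_smul, Real.norm_of_nonneg (weight_nonneg θ hs)]
  exact mul_le_of_le_one_right (weight_nonneg θ hs) (norm_projG_le n hs)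

theorem integrableOn_projIntegrand {θ : ℝ} (hθ : θ ∈ Ioo 0 Real.pi) (n : ℕ) :
    IntegrableOn (projIntegrand θ n) (Ioi 0) := by
  refine Integrable.mono' (integrableOn_weight hθ) ?_ ?_
  · exact ((continuousOn_weight θ).smul (continuousOn_projG n)).aestronglyMeasurable
      measurableSet_Ioi
  · filter_upwards [ae_restrict_mem measurableSet_Ioi] with s hs
    exact norm_projIntegrand_le θ n hs

/-- The bound does not depend on `n`, so summability of the decomposition rests on the coefficients
alone. -/
theorem norm_integral_projIntegrand_le {θ : ℝ} (hθ : θ ∈ Ioo 0 Real.pi) (n : ℕ) :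
    ‖∫ s in Ioi (0 : ℝ), projIntegrand θ n s‖ ≤ √Real.pi / (√2 * Real.sin θ) := by
  rw [← integral_weight hθ]
  refine norm_integral_le_of_norm_le (integrableOn_weight hθ) ?_
  filter_upwards [ae_restrict_mem measurableSet_Ioi] with s hs
  exact norm_projIntegrand_le θ n hs

theorem trace_integral_projIntegrand {θ : ℝ} (hθ : θ ∈ Ioo 0 Real.pi) (n : ℕ) :
    TraceClass.trace (∫ s in Ioi (0 : ℝ), projIntegrand θ n s) =
      ((√Real.pi / (√2 * Real.sin θ) : ℝ) : ℂ) := by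
  rw [← TraceClass.trace.integral_comp_comm (integrableOn_projIntegrand hθ n),
    ← integral_weight hθ, ← integral_complex_ofReal]
  refine setIntegral_congr_fun measurableSet_Ioi fun s hs => ?_
  rw [projIntegrand_eq, projG_eq_rankOne n hs, ← Complex.coe_smul, map_smul,
    TraceClass.trace_rankOne, inner_self_eq_norm_sq_to_K, norm_gVec n hs]
  simp

/-- Both sides are the rising factorial of `1/2` divided by `n!`: the functional equation of Gamma,
started at `Γ(1/2) = √π`, produces it on the right. -/
theorem ring_choose_add_half (n : ℕ) :
    Ring.choose ((1 / 2 : ℝ) + n - 1) n = Real.Gamma (n + 1 / 2) / Real.Gamma (n + 1) / √Real.pi := by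
  have hG : ∀ k : ℕ, Real.Gamma (k + 1 / 2) =
      (ascPochhammer ℕ k).smeval (1 / 2 : ℝ) * √Real.pi := by
    intro k
    induction k with
    | zero =>
      rw [Nat.cast_zero, zero_add, Real.Gamma_one_half_eq, Polynomial.ascPochhammer_smeval_eq_eval]
      simp
    | succ k ih =>
      have h1 : ((k + 1 : ℕ) : ℝ) + 1 / 2 = (k + 1 / 2) + 1 := by push_cast; ring
      rw [h1, Real.Gamma_add_one (by positivity), ih, Polynomial.ascPochhammer_smeval_eq_eval,
        Polynomial.ascPochhammer_smeval_eq_eval, ascPochhammer_succ_eval]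
      ring
  have hfact := Ring.factorial_nsmul_multichoose_eq_ascPochhammer (1 / 2 : ℝ) n
  have hpi : √Real.pi ≠ 0 := (Real.sqrt_pos.2 Real.pi_pos).ne'
  have hn : ((n.factorial : ℕ) : ℝ) ≠ 0 := by positivity
  rw [← Ring.multichoose_eq, hG, Real.Gamma_nat_eq_factorial, ← hfact, nsmul_eq_mul]
  field_simp

/-- The binomial series of `(1 - x)^(-1/2)`. It serves twice: for convergence at `|cos θ|` and for
the traces at `± cos θ`. -/
theorem hasSum_gamma_mul_pow {x : ℝ} (hx : |x| < 1) :
    HasSum (fun n : ℕ => Real.Gamma (n + 1 / 2) / Real.Gamma (n + 1) * x ^ n)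
      (√Real.pi / √(1 - x)) := by
  have h := (Real.one_div_one_sub_rpow_hasFPowerSeriesOnBall_zero (1 / 2)).hasSum
    (y := x) (by simpa [Metric.mem_eball, edist_dist] using hx)
  rw [zero_add, ← Real.sqrt_eq_rpow] at h
  have h2 := h.mul_left √Real.pi
  have hpi : √Real.pi ≠ 0 := (Real.sqrt_pos.2 Real.pi_pos).ne'
  rw [mul_one_div] at h2
  refine h2.congr_fun fun n => ?_
  rw [FormalMultilinearSeries.ofScalars_apply_eq, ring_choose_add_half, smul_eq_mul]
  field_simp

end GaussianVectors

/-! ### Matrix elements of integral operators and the geometric expansion of the kernel. -/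

section KernelExpansion

open scoped ComplexConjugate

/-- The kernel is dominated by a product of square integrable functions of one variable, so the
double integral is dominated by a product of two convergent ones. -/
theorem IsDominatedKernel.integrable_prod {K : ℝ → ℝ → ℝ} (hK : IsDominatedKernel K) (ψ φ : L2R) :
    Integrable (fun z : ℝ × ℝ => conj (ψ z.1) * φ z.2 * (K z.1 z.2 : ℂ)) := by
  obtain ⟨C, hC⟩ := hK.bound
  have hint : ∀ f : L2R, Integrable (fun q => ‖f q‖ * (√(1 + q ^ 2))⁻¹) := fun f =>
    MemLp.integrable_mul (Lp.memLp f).norm memLp_inv_sqrt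
  refine (((hint ψ).mul_prod (hint φ)).const_mul C).mono' ?_ (Eventually.of_forall fun z => ?_)
  · refine ((Complex.continuous_conj.comp_stronglyMeasurable
      ((Lp.stronglyMeasurable ψ).comp_measurable measurable_fst)).mul
      ((Lp.stronglyMeasurable φ).comp_measurable measurable_snd)).aestronglyMeasurable.mul ?_
    exact (Complex.continuous_ofReal.comp hK.cont).aestronglyMeasurable
  · rw [norm_mul, norm_mul, RCLike.norm_conj, Complex.norm_real, Real.norm_eq_abs]
    calc ‖ψ z.1‖ * ‖φ z.2‖ * |K z.1 z.2|
        ≤ ‖ψ z.1‖ * ‖φ z.2‖ * (C * (√(1 + z.1 ^ 2))⁻¹ * (√(1 + z.2 ^ 2))⁻¹) := by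
          gcongr
          exact hC _ _
      _ = _ := by ring

theorem inner_integralOp {K : ℝ → ℝ → ℝ} (hK : IsDominatedKernel K) (ψ φ : L2R) :
    ⟪ψ, integralOp hK φ⟫_ℂ = ∫ z : ℝ × ℝ, conj (ψ z.1) * φ z.2 * (K z.1 z.2 : ℂ) := by
  have h := integral_prod _ (hK.integrable_prod ψ φ)
  rw [← Measure.volume_eq_prod] at h
  rw [h, L2.inner_def]
  refine integral_congr_ae ?_
  have hcoe : integralOp hK φ =ᵐ[volume] fun p => ∫ q, (K p q : ℂ) * φ q :=
    (hK.memLp φ).coeFn_toLp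
  filter_upwards [hcoe] with p hp
  rw [hp, RCLike.inner_apply, mul_comm, ← integral_const_mul]
  refine integral_congr_ae (Eventually.of_forall fun q => ?_)
  ring

/-- The quadratic form `p² + q² + 2 sin² θ`. -/
def quadForm (θ p q : ℝ) : ℝ := p ^ 2 + q ^ 2 + 2 * Real.sin θ ^ 2

theorem quadForm_pos {θ : ℝ} (hθ : θ ∈ Ioo 0 Real.pi) (p q : ℝ) : 0 < quadForm θ p q := by
  have hs := Real.sin_pos_of_mem_Ioo hθ
  unfold quadForm
  positivity

theorem two_mul_abs_mul_le_quadForm (θ p q : ℝ) : 2 * |p * q| ≤ quadForm θ p q := by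
  have h1 : 2 * |p * q| ≤ p ^ 2 + q ^ 2 := by
    rw [abs_mul, ← sq_abs p, ← sq_abs q]
    linarith [two_mul_le_add_sq |p| |q|]
  unfold quadForm
  linarith [sq_nonneg (Real.sin θ)]

/-- The `n`-th term `(2 p q)^n / (p² + q² + 2 sin² θ)^(n+1)` of the geometric expansion of the
kernel. -/
def kernelTerm (θ : ℝ) (n : ℕ) (p q : ℝ) : ℝ := (2 * (p * q)) ^ n / quadForm θ p q ^ (n + 1)

/-- Each factor `2pq / D` has modulus at most one. This single majorant provides both the domination
of every term and the interchange of sum and integral. -/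
theorem abs_kernelTerm_le {θ : ℝ} (hθ : θ ∈ Ioo 0 Real.pi) (n : ℕ) (p q : ℝ) :
    |kernelTerm θ n p q| ≤ kernelTerm θ 0 p q := by
  have hD := quadForm_pos hθ p q
  have h2 := two_mul_abs_mul_le_quadForm θ p q
  rw [kernelTerm, kernelTerm, abs_div, abs_pow, abs_mul, abs_of_pos two_pos,
    abs_of_pos (pow_pos hD _), pow_zero, zero_add, pow_one, pow_succ, ← div_div]
  gcongr
  rw [div_le_one (by positivity)]
  gcongr

theorem isDominatedKernel_kernelTerm {θ : ℝ} (hθ : θ ∈ Ioo 0 Real.pi) (n : ℕ) :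
    IsDominatedKernel (kernelTerm θ n) := by
  have hs := Real.sin_pos_of_mem_Ioo hθ
  refine ⟨?_, (Real.sin θ ^ 2)⁻¹, fun p q => (abs_kernelTerm_le hθ n p q).trans ?_⟩
  · unfold kernelTerm
    refine Continuous.div (by fun_prop) (by unfold quadForm; fun_prop) fun z => ?_
    exact (pow_pos (quadForm_pos hθ _ _) _).ne'
  · rw [kernelTerm, pow_zero, zero_add, pow_one, one_div, ← mul_inv, ← mul_inv]
    refine inv_anti₀ (by positivity) ?_
    have h1 : √(1 + p ^ 2) * √(1 + q ^ 2) ≤ 1 + p ^ 2 + q ^ 2 := by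
      nlinarith [Real.sq_sqrt (by positivity : 0 ≤ 1 + p ^ 2), sq_nonneg p, sq_nonneg q,
        Real.sq_sqrt (by positivity : 0 ≤ 1 + q ^ 2), sq_nonneg (√(1 + p ^ 2) - √(1 + q ^ 2))]
    have h2 := Real.sin_sq_le_one θ
    have h3 : Real.sin θ ^ 2 * (√(1 + p ^ 2) * √(1 + q ^ 2)) ≤
        Real.sin θ ^ 2 * (1 + p ^ 2 + q ^ 2) := by gcongr
    have h4 := mul_le_mul_of_nonneg_right h2 (by positivity : 0 ≤ p ^ 2 + q ^ 2)
    rw [quadForm, mul_assoc]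
    nlinarith [sq_nonneg (Real.sin θ)]

theorem abs_cos_lt_one {θ : ℝ} (hθ : θ ∈ Ioo 0 Real.pi) : |Real.cos θ| < 1 := by
  have hs := Real.sin_pos_of_mem_Ioo hθ
  rw [← sq_lt_one_iff_abs_lt_one]
  nlinarith [Real.sin_sq_add_cos_sq θ, pow_pos hs 2]

theorem hasSum_kernelTerm {θ : ℝ} (hθ : θ ∈ Ioo 0 Real.pi) (p q : ℝ) :
    HasSum (fun n => Real.sin θ / Real.pi * Real.cos θ ^ n * kernelTerm θ n p q)
      (kernelT θ 1 p q) := by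
  have hs := Real.sin_pos_of_mem_Ioo hθ
  have hD := quadForm_pos hθ p q
  have h2 := two_mul_abs_mul_le_quadForm θ p q
  set r := Real.cos θ * (2 * (p * q)) / quadForm θ p q with hr
  have hr1 : |r| < 1 := by
    rw [hr, abs_div, abs_mul, abs_mul 2, abs_of_pos (two_pos : (0 : ℝ) < 2), abs_of_pos hD,
      div_lt_one hD]
    -- The strict bound comes from `|cos θ| < 1` when `p q ≠ 0`, and from `D > 0` when `p q = 0`.
    rcases (abs_nonneg (p * q)).eq_or_lt with h0 | h0
    · rw [← h0]; simpa using hD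
    · have := abs_cos_lt_one hθ
      nlinarith
  have hne : quadForm θ p q - Real.cos θ * (2 * (p * q)) ≠ 0 := by
    have h3 := (abs_lt.1 hr1).2
    rw [hr, div_lt_one hD] at h3
    linarith
  have h := (hasSum_geometric_of_abs_lt_one hr1).mul_left
    (Real.sin θ / Real.pi / quadForm θ p q)
  have hK : kernelT θ 1 p q = Real.sin θ / Real.pi / quadForm θ p q * (1 - r)⁻¹ := by
    have h4 : (p ^ 2 - 2 * Real.cos θ * p * q + q ^ 2) / (2 * Real.sin θ ^ 2) + 1 ^ 2 =
        (quadForm θ p q - Real.cos θ * (2 * (p * q))) / (2 * Real.sin θ ^ 2) := by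
      rw [quadForm]; field_simp; ring
    have h5 : 1 - r = (quadForm θ p q - Real.cos θ * (2 * (p * q))) / quadForm θ p q := by
      rw [hr]; field_simp
    rw [kernelT, h4, h5, abs_of_pos hs]
    have := Real.pi_pos.ne'
    generalize quadForm θ p q - Real.cos θ * (2 * (p * q)) = E at *
    field_simp
  rw [hK]
  refine h.congr_fun fun n => ?_
  rw [kernelTerm, hr, div_pow, mul_pow (Real.cos θ)]
  generalize 2 * (p * q) = w
  field_simp
  ring

/-- Sum and integral may be interchanged because the `L¹` norm of the `n`-th term is at most a
multiple of `|cos θ|ⁿ` times the one with `kernelTerm θ 0`. -/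
theorem hasSum_inner_kernelTerm {θ : ℝ} (hθ : θ ∈ Ioo 0 Real.pi) (ψ φ : L2R) :
    HasSum (fun n => ((Real.sin θ / Real.pi * Real.cos θ ^ n : ℝ) : ℂ) *
      ∫ z : ℝ × ℝ, conj (ψ z.1) * φ z.2 * (kernelTerm θ n z.1 z.2 : ℂ)) ⟪ψ, hatT hθ φ⟫_ℂ := by
  have hs := Real.sin_pos_of_mem_Ioo hθ
  set c : ℕ → ℝ := fun n => Real.sin θ / Real.pi * Real.cos θ ^ n with hc
  have hint : ∀ n, Integrable fun z : ℝ × ℝ =>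
      conj (ψ z.1) * φ z.2 * (kernelTerm θ n z.1 z.2 : ℂ) := fun n =>
    (isDominatedKernel_kernelTerm hθ n).integrable_prod ψ φ
  have hsum := hasSum_integral_of_summable_integral_norm
    (F := fun n (z : ℝ × ℝ) => (c n : ℂ) * (conj (ψ z.1) * φ z.2 * (kernelTerm θ n z.1 z.2 : ℂ)))
    (fun n => (hint n).const_mul _) (by
      refine Summable.of_nonneg_of_le (fun n => integral_nonneg fun z => norm_nonneg _)
        (fun n => ?_) (((summable_geometric_of_lt_one (abs_nonneg _) (abs_cos_lt_one hθ)).mul_left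
          (Real.sin θ / Real.pi)).mul_right
          (∫ z : ℝ × ℝ, ‖conj (ψ z.1) * φ z.2 * (kernelTerm θ 0 z.1 z.2 : ℂ)‖))
      rw [← integral_const_mul]
      refine integral_mono ((hint n).const_mul _).norm ((hint 0).norm.const_mul _) fun z => ?_
      beta_reduce
      rw [norm_mul, norm_mul, norm_mul (conj (ψ z.1) * φ z.2), Complex.norm_real,
        Complex.norm_real, Complex.norm_real, hc, norm_mul, norm_pow,
        Real.norm_of_nonneg (div_nonneg hs.le Real.pi_pos.le), Real.norm_eq_abs, Real.norm_eq_abs,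
        Real.norm_eq_abs]
      have h1 := (abs_kernelTerm_le hθ n z.1 z.2).trans (le_abs_self _)
      have h2 := Real.pi_pos
      gcongr)
  rw [hatT, inner_integralOp]
  have hpt : ∀ z : ℝ × ℝ, ∑' n, (c n : ℂ) * (conj (ψ z.1) * φ z.2 * (kernelTerm θ n z.1 z.2 : ℂ)) =
      conj (ψ z.1) * φ z.2 * (kernelT θ 1 z.1 z.2 : ℂ) := fun z => by
    have h := (Complex.hasSum_ofReal.2 (hasSum_kernelTerm hθ z.1 z.2)).mul_left
      (conj (ψ z.1) * φ z.2)
    rw [← h.tsum_eq]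
    refine tsum_congr fun n => ?_
    rw [hc]
    push_cast
    ring
  simp_rw [hpt, integral_const_mul] at hsum
  exact hsum

end KernelExpansion

/-! ### The trace norm expansion of `T̂_θ`. -/

section Decomposition

open scoped ComplexConjugate

/-- The functional `S ↦ ⟪ψ, S φ⟫` on the trace class operators. -/
def TraceClass.matrixCoeff {H : Type*} [NormedAddCommGroup H] [InnerProductSpace ℂ H]
    [CompleteSpace H] (ψ φ : H) : TraceClass H →L[ℂ] ℂ :=
  innerSL ℂ ψ ∘L ContinuousLinearMap.apply ℂ H φ ∘L TraceClass.toCLML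

theorem TraceClass.matrixCoeff_apply {H : Type*} [NormedAddCommGroup H] [InnerProductSpace ℂ H]
    [CompleteSpace H] (ψ φ : H) (S : TraceClass H) :
    TraceClass.matrixCoeff ψ φ S = ⟪ψ, S.toCLM φ⟫_ℂ := rfl

theorem matrixCoeff_projIntegrand (θ : ℝ) (n : ℕ) {s : ℝ} (hs : 0 < s) (ψ φ : L2R) :
    TraceClass.matrixCoeff ψ φ (projIntegrand θ n s) =
      (weight θ s : ℂ) * (⟪ψ, gVec n s⟫_ℂ * ⟪gVec n s, φ⟫_ℂ) := by
  rw [projIntegrand_eq, projG_eq_rankOne n hs, ← Complex.coe_smul, map_smul,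
    TraceClass.matrixCoeff_apply, TraceClass.toCLM_rankOne, InnerProductSpace.rankOne_apply,
    inner_smul_right, smul_eq_mul, mul_comm ⟪gVec n s, φ⟫_ℂ]

theorem inner_gVec_mul_inner_gVec (n : ℕ) {s : ℝ} (hs : 0 < s) (ψ φ : L2R) :
    ⟪ψ, gVec n s⟫_ℂ * ⟪gVec n s, φ⟫_ℂ =
      ∫ z : ℝ × ℝ, conj (ψ z.1) * φ z.2 * ((gFun n s z.1 * gFun n s z.2 : ℝ) : ℂ) := by
  have h1 : ⟪ψ, gVec n s⟫_ℂ = ∫ p, conj (ψ p) * (gFun n s p : ℂ) := by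
    rw [L2.inner_def]
    refine integral_congr_ae ?_
    filter_upwards [coeFn_gVec n hs] with p hp
    rw [hp, RCLike.inner_apply, mul_comm]
  have h2 : ⟪gVec n s, φ⟫_ℂ = ∫ q, φ q * (gFun n s q : ℂ) := by
    rw [L2.inner_def]
    refine integral_congr_ae ?_
    filter_upwards [coeFn_gVec n hs] with p hp
    rw [hp, RCLike.inner_apply, Complex.conj_ofReal]
  rw [h1, h2, ← integral_prod_mul, ← Measure.volume_eq_prod]
  refine integral_congr_ae (Eventually.of_forall fun z => ?_)
  push_cast
  ring

/-- The weight is made for this identity: `s^(-1/2)` cancels the half power in the squared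
normalization, leaving `sⁿ`, and the three exponentials combine into that of the quadratic form. -/
theorem weight_mul_gFun_mul_gFun (θ : ℝ) (n : ℕ) {s : ℝ} (hs : 0 < s) (p q : ℝ) :
    weight θ s * (gFun n s p * gFun n s q) =
      √2 / Real.Gamma (n + 1 / 2) * (2 * (p * q)) ^ n *
        (s ^ n * Real.exp (-quadForm θ p q * s)) := by
  have h1 : (2 * s) ^ ((n : ℝ) + 1 / 2) = 2 ^ n * √2 * (s ^ n * s ^ (1 / 2 : ℝ)) := by
    rw [Real.mul_rpow two_pos.le hs.le, Real.rpow_add two_pos, Real.rpow_add hs,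
      Real.rpow_natCast, Real.rpow_natCast, ← Real.sqrt_eq_rpow]
  have h2 : s ^ (-(1 / 2) : ℝ) * s ^ (1 / 2 : ℝ) = 1 := by
    rw [← Real.rpow_add hs]; norm_num
  have h3 : Real.exp (-quadForm θ p q * s) =
      Real.exp (-2 * Real.sin θ ^ 2 * s) * (Real.exp (-p ^ 2 * s) * Real.exp (-q ^ 2 * s)) := by
    rw [← Real.exp_add, ← Real.exp_add, quadForm]; ring_nf
  calc weight θ s * (gFun n s p * gFun n s q)
      = s ^ (-(1 / 2) : ℝ) * gConst n s ^ 2 * (p * q) ^ n * (Real.exp (-2 * Real.sin θ ^ 2 * s) *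
          (Real.exp (-p ^ 2 * s) * Real.exp (-q ^ 2 * s))) := by
        rw [weight, gFun_eq, gFun_eq]; ring
    _ = (s ^ (-(1 / 2) : ℝ) * s ^ (1 / 2 : ℝ)) * (√2 / Real.Gamma (n + 1 / 2) *
          (2 * (p * q)) ^ n * (s ^ n * Real.exp (-quadForm θ p q * s))) := by
        rw [gConst_sq n hs, h1, h3]; ring
    _ = _ := by rw [h2, one_mul]

theorem integrableOn_pow_mul_exp_neg_mul (n : ℕ) {r : ℝ} (hr : 0 < r) :
    IntegrableOn (fun s : ℝ => s ^ n * Real.exp (-r * s)) (Ioi 0) := by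
  have h := integrableOn_rpow_mul_exp_neg_mul (a := n) (r := r)
    (by linarith [n.cast_nonneg (α := ℝ)]) hr
  simpa only [Real.rpow_natCast] using h

theorem integral_pow_mul_exp_neg_mul (n : ℕ) {r : ℝ} (hr : 0 < r) :
    ∫ s in Ioi (0 : ℝ), s ^ n * Real.exp (-r * s) = Real.Gamma (n + 1) / r ^ (n + 1) := by
  have h := integral_rpow_mul_exp_neg_mul (a := (n : ℝ) + 1) (by positivity) hr
  rw [add_sub_cancel_right] at h
  simp_rw [Real.rpow_natCast] at h
  rw [h]
  congr 1
  exact_mod_cast Real.rpow_natCast r (n + 1)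

/-- The matrix coefficient passes under the Bochner integral, Fubini puts the `s` integral inside,
and there it is a Gamma integral that returns the `n`-th kernel term. -/
theorem inner_integral_projIntegrand {θ : ℝ} (hθ : θ ∈ Ioo 0 Real.pi) (n : ℕ) (ψ φ : L2R) :
    TraceClass.matrixCoeff ψ φ (∫ s in Ioi (0 : ℝ), projIntegrand θ n s) =
      ((√2 * (Real.Gamma (n + 1) / Real.Gamma (n + 1 / 2)) : ℝ) : ℂ) *
        ∫ z : ℝ × ℝ, conj (ψ z.1) * φ z.2 * (kernelTerm θ n z.1 z.2 : ℂ) := by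
  set c : ℝ := √2 * (Real.Gamma (n + 1) / Real.Gamma (n + 1 / 2)) with hc
  set B : ℝ × ℝ → ℝ := fun z => √2 / Real.Gamma (n + 1 / 2) * (2 * (z.1 * z.2)) ^ n with hB
  set E : ℝ → ℝ × ℝ → ℝ := fun s z => s ^ n * Real.exp (-quadForm θ z.1 z.2 * s) with hE
  set F : ℝ → ℝ × ℝ → ℂ := fun s z => conj (ψ z.1) * φ z.2 * ((B z * E s z : ℝ) : ℂ) with hF
  have hBc : ∀ z : ℝ × ℝ, B z * (Real.Gamma (n + 1) / quadForm θ z.1 z.2 ^ (n + 1)) =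
      c * kernelTerm θ n z.1 z.2 := fun z => by rw [hB, hc, kernelTerm]; ring
  have hEint : ∀ z : ℝ × ℝ, IntegrableOn (fun s => E s z) (Ioi 0) := fun z =>
    integrableOn_pow_mul_exp_neg_mul n (quadForm_pos hθ z.1 z.2)
  have hEval : ∀ z : ℝ × ℝ, ∫ s in Ioi (0 : ℝ), E s z =
      Real.Gamma (n + 1) / quadForm θ z.1 z.2 ^ (n + 1) := fun z =>
    integral_pow_mul_exp_neg_mul n (quadForm_pos hθ z.1 z.2)
  have hk : Integrable fun z : ℝ × ℝ =>
      conj (ψ z.1) * φ z.2 * ((c * kernelTerm θ n z.1 z.2 : ℝ) : ℂ) := by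
    refine (((isDominatedKernel_kernelTerm hθ n).integrable_prod ψ φ).const_mul (c : ℂ)).congr
      (Eventually.of_forall fun z => ?_)
    push_cast
    ring
  have hFint : Integrable (Function.uncurry F)
      ((volume.restrict (Ioi (0 : ℝ))).prod (volume : Measure (ℝ × ℝ))) := by
    have hmeas : AEStronglyMeasurable (Function.uncurry F)
        ((volume.restrict (Ioi (0 : ℝ))).prod (volume : Measure (ℝ × ℝ))) := by
      have hm1 : StronglyMeasurable fun w : ℝ × ℝ × ℝ => conj (ψ w.2.1) * φ w.2.2 :=
        (Complex.continuous_conj.comp_stronglyMeasurable ((Lp.stronglyMeasurable ψ).comp_measurable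
          (by fun_prop : Measurable fun w : ℝ × ℝ × ℝ => w.2.1))).mul
          ((Lp.stronglyMeasurable φ).comp_measurable
            (by fun_prop : Measurable fun w : ℝ × ℝ × ℝ => w.2.2))
      have hm2 : Continuous fun w : ℝ × ℝ × ℝ => ((B w.2 * E w.1 w.2 : ℝ) : ℂ) := by
        simp only [hB, hE, quadForm]
        fun_prop
      exact (hm1.mul hm2.stronglyMeasurable).aestronglyMeasurable
    -- Absolute integrability is tested with `s` integrated first. As `E` is nonnegative on `s > 0`,
    -- this gives exactly the modulus of the function in `hk`.
    refine (integrable_prod_iff' hmeas).2 ⟨Eventually.of_forall fun z => ?_, ?_⟩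
    · exact (((hEint z).const_mul (B z)).ofReal (𝕜 := ℂ)).const_mul (conj (ψ z.1) * φ z.2)
    · refine hk.norm.congr (Eventually.of_forall fun z => ?_)
      have h1 : ∀ s ∈ Ioi (0 : ℝ), ‖F s z‖ = ‖conj (ψ z.1) * φ z.2‖ * |B z| * E s z :=
        fun s (hs : 0 < s) => by
          have h2 : 0 ≤ E s z := by simp only [hE]; positivity
          rw [hF, norm_mul, Complex.norm_real, Real.norm_eq_abs, abs_mul, abs_of_nonneg h2,
            mul_assoc]
      have h3 : 0 ≤ Real.Gamma (n + 1) / quadForm θ z.1 z.2 ^ (n + 1) :=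
        div_nonneg (Real.Gamma_pos_of_pos (by positivity)).le
          (pow_pos (quadForm_pos hθ _ _) _).le
      change _ = ∫ s in Ioi (0 : ℝ), ‖F s z‖
      rw [setIntegral_congr_fun measurableSet_Ioi h1, integral_const_mul, hEval, ← abs_of_nonneg h3,
        mul_assoc, ← abs_mul, hBc, ← Real.norm_eq_abs, ← Complex.norm_real, ← norm_mul]
  rw [← (TraceClass.matrixCoeff ψ φ).integral_comp_comm (integrableOn_projIntegrand hθ n)]
  have hstep : ∀ s ∈ Ioi (0 : ℝ), TraceClass.matrixCoeff ψ φ (projIntegrand θ n s) =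
      ∫ z, F s z := fun s hs => by
    rw [matrixCoeff_projIntegrand θ n hs, inner_gVec_mul_inner_gVec n hs, ← integral_const_mul]
    refine integral_congr_ae (Eventually.of_forall fun z => ?_)
    simp only [hF, hB, hE]
    rw [← weight_mul_gFun_mul_gFun θ n hs]
    push_cast
    ring
  rw [setIntegral_congr_fun measurableSet_Ioi hstep, integral_integral_swap hFint,
    ← integral_const_mul]
  refine integral_congr_ae (Eventually.of_forall fun z => ?_)
  simp only [hF]
  rw [integral_const_mul, integral_complex_ofReal, integral_const_mul, hEval, hBc]
  push_cast
  ring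

/-- The coefficients of the decomposition of `T̂_θ`. -/
def decompCoeff (θ : ℝ) (n : ℕ) : ℝ :=
  (2 : ℝ) ^ (-(1 / 2) : ℝ) * (Real.sin θ / Real.pi) *
    (Real.Gamma (n + 1 / 2) / Real.Gamma (n + 1)) * Real.cos θ ^ n

/-- The terms of the decomposition of `T̂_θ`. -/
def decompTerm (θ : ℝ) (n : ℕ) : TraceClass L2R :=
  decompCoeff θ n • ∫ s in Ioi (0 : ℝ), projIntegrand θ n s

theorem matrixCoeff_decompTerm {θ : ℝ} (hθ : θ ∈ Ioo 0 Real.pi) (n : ℕ) (ψ φ : L2R) :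
    TraceClass.matrixCoeff ψ φ (decompTerm θ n) =
      ((Real.sin θ / Real.pi * Real.cos θ ^ n : ℝ) : ℂ) *
        ∫ z : ℝ × ℝ, conj (ψ z.1) * φ z.2 * (kernelTerm θ n z.1 z.2 : ℂ) := by
  rw [decompTerm, ← Complex.coe_smul, map_smul, inner_integral_projIntegrand hθ, smul_eq_mul,
    ← mul_assoc, ← Complex.ofReal_mul]
  congr 2
  have h1 : Real.Gamma ((n : ℝ) + 1) ≠ 0 := (Real.Gamma_pos_of_pos (by positivity)).ne'
  have h2 := (gamma_add_half_pos n).ne'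
  have h3 : (√2 : ℝ) ≠ 0 := by positivity
  rw [decompCoeff, Real.rpow_neg two_pos.le, ← Real.sqrt_eq_rpow]
  field_simp

theorem summable_norm_decompTerm {θ : ℝ} (hθ : θ ∈ Ioo 0 Real.pi) :
    Summable fun n => ‖decompTerm θ n‖ := by
  have hs := Real.sin_pos_of_mem_Ioo hθ
  have h := (hasSum_gamma_mul_pow (x := |Real.cos θ|)
    (by rw [abs_abs]; exact abs_cos_lt_one hθ)).summable
  refine Summable.of_nonneg_of_le (fun _ => norm_nonneg _) (fun n => ?_)
    ((h.mul_left ((2 : ℝ) ^ (-(1 / 2) : ℝ) * (Real.sin θ / Real.pi))).mul_right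
      (√Real.pi / (√2 * Real.sin θ)))
  have h1 : |decompCoeff θ n| = (2 : ℝ) ^ (-(1 / 2) : ℝ) * (Real.sin θ / Real.pi) *
      (Real.Gamma (n + 1 / 2) / Real.Gamma (n + 1) * |Real.cos θ| ^ n) := by
    rw [decompCoeff, abs_mul, abs_pow, abs_of_nonneg, mul_assoc]
    have h2 := gamma_add_half_pos n
    have h3 : 0 < Real.Gamma ((n : ℝ) + 1) := Real.Gamma_pos_of_pos (by positivity)
    have := Real.pi_pos
    positivity
  rw [decompTerm, norm_smul, Real.norm_eq_abs, h1]
  have h2 := norm_integral_projIntegrand_le hθ n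
  gcongr

/-- An operator is determined by its matrix elements, and on both sides these are sums of the same
scalar series. -/
theorem toCLM_tsum_decompTerm {θ : ℝ} (hθ : θ ∈ Ioo 0 Real.pi) :
    (∑' n, decompTerm θ n).toCLM = hatT hθ := by
  refine ContinuousLinearMap.ext fun φ => ext_inner_left ℂ fun ψ => ?_
  have h := (TraceClass.matrixCoeff ψ φ).hasSum (summable_norm_decompTerm hθ).of_norm.hasSum
  simp_rw [matrixCoeff_decompTerm hθ] at h
  exact h.unique (hasSum_inner_kernelTerm hθ ψ φ)

end Decomposition

/-! ### Parity, signs, traces and trace norms. -/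

section MainTheorem

theorem parityOp_gVec (n : ℕ) {s : ℝ} (hs : 0 < s) :
    parityOp (gVec n s) = ((-1 : ℂ) ^ n) • gVec n s := by
  refine Lp.ext ?_
  have h1 : parityOp (gVec n s) =ᵐ[volume] fun p => gVec n s (-p) :=
    Lp.coeFn_compMeasurePreserving _ (Measure.measurePreserving_neg (volume : Measure ℝ))
  have h2 := (Measure.measurePreserving_neg
    (volume : Measure ℝ)).quasiMeasurePreserving.ae_eq_comp (coeFn_gVec n hs)
  filter_upwards [h1, h2, coeFn_gVec n hs, Lp.coeFn_smul ((-1 : ℂ) ^ n) (gVec n s)]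
    with p h1 h2 h3 h4
  simp only [Function.comp_apply] at h2
  rw [h1, h2, h4, Pi.smul_apply, h3, gFun_eq, gFun_eq, neg_sq, neg_pow p, smul_eq_mul]
  push_cast
  ring

/-- Composition with `Π` is continuous from the trace class to the bounded operators, so it passes
under the integral, where the parity of `g_{n,s}` decides. -/
theorem parityOp_comp_decompTerm {θ : ℝ} (hθ : θ ∈ Ioo 0 Real.pi) (n : ℕ) :
    parityOp ∘L (decompTerm θ n).toCLM = ((-1 : ℂ) ^ n) • (decompTerm θ n).toCLM := by
  have hI := integrableOn_projIntegrand hθ n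
  set L : TraceClass L2R →L[ℂ] (L2R →L[ℂ] L2R) :=
    (ContinuousLinearMap.compL ℂ L2R L2R L2R parityOp) ∘L TraceClass.toCLML with hL
  have h : L (∫ s in Ioi (0 : ℝ), projIntegrand θ n s) =
      ((-1 : ℂ) ^ n • TraceClass.toCLML) (∫ s in Ioi (0 : ℝ), projIntegrand θ n s) := by
    rw [← L.integral_comp_comm hI, ← ContinuousLinearMap.integral_comp_comm _ hI]
    refine setIntegral_congr_fun measurableSet_Ioi fun s hs => ?_
    have h1 : parityOp ∘L (projG n s).toCLM = ((-1 : ℂ) ^ n) • (projG n s).toCLM := by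
      rw [projG_eq_rankOne n hs, TraceClass.toCLM_rankOne, InnerProductSpace.comp_rankOne,
        parityOp_gVec n hs, map_smul]
      rfl
    rw [projIntegrand_eq, ← Complex.coe_smul, map_smul, map_smul]
    exact congrArg _ h1
  have h2 : parityOp ∘L (decompTerm θ n).toCLM = L (decompTerm θ n) := rfl
  have h3 : ((-1 : ℂ) ^ n) • (decompTerm θ n).toCLM =
    ((-1 : ℂ) ^ n • TraceClass.toCLML) (decompTerm θ n) := rfl
  rw [h2, h3, decompTerm, ← Complex.coe_smul, map_smul, map_smul, h]

/-- Meant for `Q = (1 ± Π)/2`: applied termwise to the full series, `Q` keeps the terms of one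
parity and kills the others. -/
theorem toCLM_tsum_decompTerm_comp {θ : ℝ} (hθ : θ ∈ Ioo 0 Real.pi) (Q : L2R →L[ℂ] L2R)
    {g : ℕ → ℕ} (hg : Function.Injective g)
    (hQ : ∀ n, Q ∘L (decompTerm θ (g n)).toCLM = (decompTerm θ (g n)).toCLM)
    (hQ0 : ∀ n ∉ range g, Q ∘L (decompTerm θ n).toCLM = 0) :
    (∑' n, decompTerm θ (g n)).toCLM = Q ∘L hatT hθ := by
  have hs := (summable_norm_decompTerm hθ).of_norm
  have h1 := TraceClass.toCLML.hasSum (hs.comp_injective hg).hasSum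
  have h2 := (ContinuousLinearMap.compL ℂ L2R L2R L2R Q ∘L TraceClass.toCLML).hasSum hs.hasSum
  have h3 := ((hg.hasSum_iff hQ0).2 h2).unique (h1.congr_fun hQ)
  rw [← toCLM_tsum_decompTerm hθ]
  exact h3.symm

theorem toCLM_tsum_even {θ : ℝ} (hθ : θ ∈ Ioo 0 Real.pi) :
    (∑' n, decompTerm θ (2 * n)).toCLM = hatTPlus hθ := by
  refine toCLM_tsum_decompTerm_comp hθ _ (mul_right_injective₀ two_ne_zero) (fun n => ?_)
    fun n hn => ?_
  · rw [ContinuousLinearMap.smul_comp, ContinuousLinearMap.add_comp, parityOp_comp_decompTerm hθ,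
      (even_two_mul n).neg_one_pow, one_smul, ContinuousLinearMap.one_def,
      ContinuousLinearMap.id_comp, ← two_smul ℂ, smul_smul]
    norm_num
  · have hodd : Odd n := Nat.not_even_iff_odd.1 fun h => hn (by
      obtain ⟨k, rfl⟩ := h.two_dvd
      exact ⟨k, rfl⟩)
    rw [ContinuousLinearMap.smul_comp, ContinuousLinearMap.add_comp, parityOp_comp_decompTerm hθ,
      hodd.neg_one_pow, neg_one_smul, ContinuousLinearMap.one_def,
      ContinuousLinearMap.id_comp, add_neg_cancel, smul_zero]

theorem toCLM_tsum_odd {θ : ℝ} (hθ : θ ∈ Ioo 0 Real.pi) :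
    (∑' n, decompTerm θ (2 * n + 1)).toCLM = hatTMinus hθ := by
  refine toCLM_tsum_decompTerm_comp hθ _
    ((add_left_injective 1).comp (mul_right_injective₀ two_ne_zero)) (fun n => ?_) fun n hn => ?_
  · rw [ContinuousLinearMap.smul_comp, ContinuousLinearMap.sub_comp, parityOp_comp_decompTerm hθ]
    rw [(odd_two_mul_add_one n).neg_one_pow, neg_one_smul, ContinuousLinearMap.one_def,
      ContinuousLinearMap.id_comp, sub_neg_eq_add, ← two_smul ℂ, smul_smul]
    norm_num
  · have heven : Even n := Nat.not_odd_iff_even.1 fun h => hn (by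
      obtain ⟨k, rfl⟩ := h
      exact ⟨k, rfl⟩)
    rw [ContinuousLinearMap.smul_comp, ContinuousLinearMap.sub_comp, parityOp_comp_decompTerm hθ,
      heven.neg_one_pow, one_smul, ContinuousLinearMap.one_def,
      ContinuousLinearMap.id_comp, sub_self, smul_zero]

theorem matrixCoeff_self_integral_projIntegrand {θ : ℝ} (hθ : θ ∈ Ioo 0 Real.pi) (n : ℕ)
    (φ : L2R) : TraceClass.matrixCoeff φ φ (∫ s in Ioi (0 : ℝ), projIntegrand θ n s) =
      ((∫ s in Ioi (0 : ℝ), weight θ s * ‖⟪gVec n s, φ⟫_ℂ‖ ^ 2 : ℝ) : ℂ) := by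
  rw [← (TraceClass.matrixCoeff φ φ).integral_comp_comm (integrableOn_projIntegrand hθ n),
    ← integral_complex_ofReal]
  refine setIntegral_congr_fun measurableSet_Ioi fun s hs => ?_
  rw [matrixCoeff_projIntegrand θ n hs, ← inner_conj_symm φ, Complex.conj_mul']
  push_cast
  rfl

/-- The quadratic form of the sum is a series of integrals of `weight θ s * ‖⟪gVec n s, φ⟫‖²` with
nonnegative coefficients. -/
theorem nonneg_of_hasSum {θ : ℝ} (hθ : θ ∈ Ioo 0 Real.pi) {a : ℕ → ℝ} (ha : ∀ n, 0 ≤ a n)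
    {g : ℕ → ℕ} {S : TraceClass L2R}
    (hS : HasSum (fun n => a n • ∫ s in Ioi (0 : ℝ), projIntegrand θ (g n) s) S) :
    0 ≤ S.toCLM := by
  rw [ContinuousLinearMap.nonneg_iff_isPositive, ContinuousLinearMap.isPositive_iff_complex]
  intro φ
  have h := (TraceClass.matrixCoeff φ φ).hasSum hS
  simp_rw [← Complex.coe_smul (E := TraceClass L2R), map_smul,
    matrixCoeff_self_integral_projIntegrand hθ, smul_eq_mul, ← Complex.ofReal_mul] at h
  have hr := Complex.hasSum_re h
  simp_rw [Complex.ofReal_re] at hr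
  have hval := h.unique (Complex.hasSum_ofReal.2 hr)
  have h0 := hr.nonneg fun n => mul_nonneg (ha n) (setIntegral_nonneg measurableSet_Ioi
    fun s hs => mul_nonneg (weight_nonneg θ hs) (sq_nonneg _))
  rw [TraceClass.matrixCoeff_apply] at hval h0
  -- The positivity criterion has the operator in the first slot of the inner product; the value is
  -- real, so swapping the slots costs nothing.
  rw [← inner_conj_symm, hval, Complex.conj_ofReal]
  exact ⟨by simp, by simpa using h0⟩

theorem trace_decompTerm {θ : ℝ} (hθ : θ ∈ Ioo 0 Real.pi) (n : ℕ) :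
    TraceClass.trace (decompTerm θ n) = ((1 / (2 * √Real.pi) *
      (Real.Gamma (n + 1 / 2) / Real.Gamma (n + 1) * Real.cos θ ^ n) : ℝ) : ℂ) := by
  have hs := (Real.sin_pos_of_mem_Ioo hθ).ne'
  rw [decompTerm, ← Complex.coe_smul, map_smul, trace_integral_projIntegrand hθ, smul_eq_mul,
    ← Complex.ofReal_mul]
  congr 1
  have h2 : (√2 : ℝ) * √2 = 2 := Real.mul_self_sqrt two_pos.le
  have h3 : √Real.pi * √Real.pi = Real.pi := Real.mul_self_sqrt Real.pi_pos.le
  have h4 : √Real.pi ≠ 0 := (Real.sqrt_pos.2 Real.pi_pos).ne'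
  rw [decompCoeff, Real.rpow_neg two_pos.le, ← Real.sqrt_eq_rpow]
  have h5 : Real.sin θ / Real.pi = Real.sin θ / (√Real.pi * √Real.pi) := by rw [h3]
  rw [h5]
  generalize Real.Gamma (n + 1 / 2) / Real.Gamma (n + 1) = G
  generalize √Real.pi = P at *
  field_simp
  rw [sq, h2]
  ring

theorem sqrt_one_sub_cos {θ : ℝ} (hθ : θ ∈ Ioo 0 Real.pi) :
    √(1 - Real.cos θ) = √2 * Real.sin (θ / 2) := by
  have h0 : 0 ≤ Real.sin (θ / 2) :=
    Real.sin_nonneg_of_nonneg_of_le_pi (by linarith [hθ.1]) (by linarith [hθ.1, hθ.2])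
  have h1 : 1 - Real.cos θ = 2 * Real.sin (θ / 2) ^ 2 := by
    have := Real.cos_sq' (θ / 2)
    have h2 := Real.cos_two_mul (θ / 2)
    rw [mul_div_cancel₀ θ two_ne_zero] at h2
    linarith
  rw [h1, Real.sqrt_mul two_pos.le, Real.sqrt_sq h0]

theorem sqrt_one_add_cos {θ : ℝ} (hθ : θ ∈ Ioo 0 Real.pi) :
    √(1 + Real.cos θ) = √2 * Real.cos (θ / 2) := by
  have h0 : 0 ≤ Real.cos (θ / 2) :=
    Real.cos_nonneg_of_neg_pi_div_two_le_of_le (by linarith [hθ.1, Real.pi_pos])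
      (by linarith [hθ.2])
  have h1 : 1 + Real.cos θ = 2 * Real.cos (θ / 2) ^ 2 := by
    have h2 := Real.cos_two_mul (θ / 2)
    rw [mul_div_cancel₀ θ two_ne_zero] at h2
    linarith
  rw [h1, Real.sqrt_mul two_pos.le, Real.sqrt_sq h0]

/-- If `E` and `O` are the even and odd parts of the trace series, then `E + O` is the binomial
series at `cos θ` and `E - O` the one at `-cos θ`. The half-angle formulas evaluate both, and half
the sum and half the difference give the claim. -/
theorem trace_tsum_even_and_odd {θ : ℝ} (hθ : θ ∈ Ioo 0 Real.pi) :
    TraceClass.trace (∑' n, decompTerm θ (2 * n)) =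
      (((Real.cos (θ / 2) + Real.sin (θ / 2)) / (2 * √2 * Real.sin θ) : ℝ) : ℂ) ∧
    TraceClass.trace (∑' n, decompTerm θ (2 * n + 1)) =
      (((Real.cos (θ / 2) - Real.sin (θ / 2)) / (2 * √2 * Real.sin θ) : ℝ) : ℂ) := by
  have hx := abs_cos_lt_one hθ
  have hs := (summable_norm_decompTerm hθ).of_norm
  have he : Function.Injective fun n : ℕ => 2 * n := mul_right_injective₀ two_ne_zero
  have ho : Function.Injective fun n : ℕ => 2 * n + 1 := (add_left_injective 1).comp he
  set f : ℕ → ℝ := fun n =>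
    1 / (2 * √Real.pi) * (Real.Gamma (n + 1 / 2) / Real.Gamma (n + 1) * Real.cos θ ^ n) with hf
  have hpi : √Real.pi ≠ 0 := (Real.sqrt_pos.2 Real.pi_pos).ne'
  have hp : HasSum f (1 / (2 * √2 * Real.sin (θ / 2))) := by
    have h := (hasSum_gamma_mul_pow hx).mul_left (1 / (2 * √Real.pi))
    rw [sqrt_one_sub_cos hθ] at h
    convert! h using 1
    field_simp
  have hm : HasSum (fun n => (-1) ^ n * f n) (1 / (2 * √2 * Real.cos (θ / 2))) := by
    have h := (hasSum_gamma_mul_pow (x := -Real.cos θ) (by rwa [abs_neg])).mul_left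
      (1 / (2 * √Real.pi))
    rw [sub_neg_eq_add, sqrt_one_add_cos hθ] at h
    convert! h using 1
    · ext n
      simp only [hf]
      rw [neg_pow (Real.cos θ)]
      ring
    · field_simp
  have hE := (hp.summable.comp_injective he).hasSum
  have hO := (hp.summable.comp_injective ho).hasSum
  simp only [Function.comp_def] at hE hO
  set E := ∑' n, f (2 * n)
  set O := ∑' n, f (2 * n + 1)
  have h1 : E + O = 1 / (2 * √2 * Real.sin (θ / 2)) := (hE.even_add_odd hO).unique hp
  have h2 : E + -O = 1 / (2 * √2 * Real.cos (θ / 2)) := by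
    refine (HasSum.even_add_odd (f := fun n => (-1) ^ n * f n) ?_ ?_).unique hm
    · refine hE.congr_fun fun n => ?_
      rw [(even_two_mul n).neg_one_pow, one_mul]
    · refine hO.neg.congr_fun fun n => ?_
      rw [(odd_two_mul_add_one n).neg_one_pow, neg_one_mul]
  have hsin : 0 < Real.sin (θ / 2) :=
    Real.sin_pos_of_pos_of_lt_pi (by linarith [hθ.1]) (by linarith [hθ.1, hθ.2])
  have hcos : 0 < Real.cos (θ / 2) :=
    Real.cos_pos_of_mem_Ioo ⟨by linarith [hθ.1, Real.pi_pos], by linarith [hθ.2]⟩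
  have hdouble : Real.sin θ = 2 * Real.sin (θ / 2) * Real.cos (θ / 2) := by
    rw [← Real.sin_two_mul, mul_div_cancel₀ θ two_ne_zero]
  have h3 : (√2 : ℝ) ≠ 0 := by positivity
  constructor
  · have h := TraceClass.trace.hasSum (hs.comp_injective he).hasSum
    simp only [Function.comp_def, trace_decompTerm hθ] at h
    refine h.unique ((Complex.hasSum_ofReal.2 hE).congr_fun fun n => rfl) |>.trans ?_
    have : E = (1 / (2 * √2 * Real.sin (θ / 2)) + 1 / (2 * √2 * Real.cos (θ / 2))) / 2 := by
      linarith
    rw [this, hdouble]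
    congr 1
    field_simp
  · have h := TraceClass.trace.hasSum (hs.comp_injective ho).hasSum
    simp only [Function.comp_def, trace_decompTerm hθ] at h
    refine h.unique ((Complex.hasSum_ofReal.2 hO).congr_fun fun n => rfl) |>.trans ?_
    have : O = (1 / (2 * √2 * Real.sin (θ / 2)) - 1 / (2 * √2 * Real.cos (θ / 2))) / 2 := by
      linarith
    rw [this, hdouble]
    congr 1
    field_simp

theorem star_parityOp_mul_parityOp : star parityOp * parityOp = 1 := by
  refine ContinuousLinearMap.ext fun φ => ext_inner_left ℂ fun ψ => ?_
  rw [mul_apply_eq_comp, ContinuousLinearMap.star_eq_adjoint,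
    ContinuousLinearMap.adjoint_inner_right, parityOp]
  exact LinearIsometry.inner_map_map _ _ _

theorem hatTPlus_add_hatTMinus {θ : ℝ} (hθ : θ ∈ Ioo 0 Real.pi) :
    hatTPlus hθ + hatTMinus hθ = hatT hθ := by
  rw [hatTPlus, hatTMinus, ← ContinuousLinearMap.add_comp, ← smul_add, add_add_sub_cancel,
    ← two_smul ℂ, smul_smul]
  norm_num
  rfl

theorem parityOp_mul_hatT {θ : ℝ} (hθ : θ ∈ Ioo 0 Real.pi) :
    parityOp * hatT hθ = hatTPlus hθ - hatTMinus hθ := by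
  rw [hatTPlus, hatTMinus, ← ContinuousLinearMap.sub_comp, ← smul_sub, add_sub_sub_cancel,
    ← two_smul ℂ, smul_smul]
  norm_num
  rfl

theorem fourierConj_eq (A : L2R →L[ℂ] L2R) :
    fourierConj A = unitaryFourier.symm.conjStarAlgEquiv A := rfl

theorem trace_facts_of_fourierConj {A : L2R →L[ℂ] L2R} {τ : ℂ} {ν : ℝ}
    (htr : HasTrace A τ) (hnorm : traceNorm A = ENNReal.ofReal ν) :
    ∀ T ∈ ({fourierConj A, A} : Set (L2R →L[ℂ] L2R)),
      IsTraceClass T ∧ HasTrace T τ ∧ traceNorm T = ENNReal.ofReal ν := by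
  have hlt : ∀ T : L2R →L[ℂ] L2R, traceNorm T = ENNReal.ofReal ν → IsTraceClass T := fun T hT => by
    rw [IsTraceClass, hT]
    exact ENNReal.ofReal_lt_top
  rintro T (rfl | rfl)
  · have h : traceNorm (fourierConj A) = ENNReal.ofReal ν := by
      rw [fourierConj_eq, traceNorm_conj, hnorm]
    exact ⟨hlt _ h, htr.conj _, h⟩
  · exact ⟨hlt _ hnorm, htr, hnorm⟩

theorem TraceClass.hasTrace_of_nonneg {H : Type*} [NormedAddCommGroup H] [InnerProductSpace ℂ H]
    [CompleteSpace H] {T : TraceClass H} (hT : 0 ≤ T.toCLM) :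
    HasTrace T.toCLM (TraceClass.trace T) := by
  have h := HasTrace.of_nonneg hT T.isTraceClass
  rwa [(h _ (onb H)).unique T.hasSum_trace] at h

end MainTheorem

end

theorem mainTheorem3 (θ : ℝ) (hθ : θ ∈ Set.Ioo 0 Real.pi) :
    -- the integrals exist as Bochner integrals for the trace norm
    (∀ n : ℕ, IntegrableOn (projIntegrand θ n) (Set.Ioi 0)) ∧
    -- the three decompositions, with convergence in trace norm
    (∃ S : TraceClass L2R, S.toCLM = hatT hθ ∧
      HasSum (fun n : ℕ =>
        ((2 : ℝ) ^ (-(1 / 2) : ℝ) * (Real.sin θ / Real.pi) *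
          (Real.Gamma (n + 1 / 2) / Real.Gamma (n + 1)) * Real.cos θ ^ n) •
            ∫ s in Set.Ioi (0 : ℝ), projIntegrand θ n s) S) ∧
    (∃ S : TraceClass L2R, S.toCLM = hatTPlus hθ ∧
      HasSum (fun n : ℕ =>
        ((2 : ℝ) ^ (-(1 / 2) : ℝ) * (Real.sin θ / Real.pi) *
          (Real.Gamma (2 * n + 1 / 2) / Real.Gamma (2 * n + 1)) * Real.cos θ ^ (2 * n)) •
            ∫ s in Set.Ioi (0 : ℝ), projIntegrand θ (2 * n) s) S) ∧
    (∃ S : TraceClass L2R, S.toCLM = hatTMinus hθ ∧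
      HasSum (fun n : ℕ =>
        ((2 : ℝ) ^ (-(1 / 2) : ℝ) * (Real.sin θ / Real.pi) *
          (Real.Gamma (2 * n + 3 / 2) / Real.Gamma (2 * n + 2)) * Real.cos θ ^ (2 * n + 1)) •
            ∫ s in Set.Ioi (0 : ℝ), projIntegrand θ (2 * n + 1) s) S) ∧
    -- the signs
    (θ ≤ Real.pi / 2 → (hatTPlus hθ).IsPositive ∧ (hatTMinus hθ).IsPositive) ∧
    (Real.pi / 2 ≤ θ → (hatTPlus hθ).IsPositive ∧ (-hatTMinus hθ).IsPositive) ∧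
    -- the trace class property, traces and trace norms, in both representations
    (∀ T ∈ ({opTPlus hθ, hatTPlus hθ} : Set (L2R →L[ℂ] L2R)),
      IsTraceClass T ∧
      HasTrace T (((Real.cos (θ / 2) + Real.sin (θ / 2)) / (2 * √2 * Real.sin θ) : ℝ) : ℂ) ∧
      traceNorm T =
        ENNReal.ofReal ((Real.cos (θ / 2) + Real.sin (θ / 2)) / (2 * √2 * Real.sin θ))) ∧
    (∀ T ∈ ({opTMinus hθ, hatTMinus hθ} : Set (L2R →L[ℂ] L2R)),
      IsTraceClass T ∧
      HasTrace T (((Real.cos (θ / 2) - Real.sin (θ / 2)) / (2 * √2 * Real.sin θ) : ℝ) : ℂ) ∧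
      traceNorm T =
        ENNReal.ofReal (|Real.cos (θ / 2) - Real.sin (θ / 2)| / (2 * √2 * Real.sin θ))) ∧
    (∀ T ∈ ({opT hθ, hatT hθ} : Set (L2R →L[ℂ] L2R)),
      IsTraceClass T ∧
      HasTrace T ((1 / (2 * √2 * Real.sin (θ / 2)) : ℝ) : ℂ) ∧
      traceNorm T =
        ENNReal.ofReal (max (Real.cos (θ / 2)) (Real.sin (θ / 2)) / (√2 * Real.sin θ))) := by
  have hsum := (summable_norm_decompTerm hθ).of_norm
  have he : Function.Injective fun n : ℕ => 2 * n := mul_right_injective₀ two_ne_zero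
  have ho : Function.Injective fun n : ℕ => 2 * n + 1 := (add_left_injective 1).comp he
  set S := ∑' n, decompTerm θ n
  set Sp := ∑' n, decompTerm θ (2 * n) with hSp
  set Sm := ∑' n, decompTerm θ (2 * n + 1) with hSm
  have hSsum : HasSum (decompTerm θ) S := hsum.hasSum
  have hSpsum : HasSum (fun n => decompTerm θ (2 * n)) Sp := (hsum.comp_injective he).hasSum
  have hSmsum : HasSum (fun n => decompTerm θ (2 * n + 1)) Sm := (hsum.comp_injective ho).hasSum
  have hST : S.toCLM = hatT hθ := toCLM_tsum_decompTerm hθ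
  have hSpT : Sp.toCLM = hatTPlus hθ := toCLM_tsum_even hθ
  have hSmT : Sm.toCLM = hatTMinus hθ := toCLM_tsum_odd hθ
  have hsin := Real.sin_pos_of_mem_Ioo hθ
  have hc0 : ∀ n : ℕ, 0 ≤ (2 : ℝ) ^ (-(1 / 2) : ℝ) * (Real.sin θ / Real.pi) *
      (Real.Gamma (n + 1 / 2) / Real.Gamma (n + 1)) := fun n => by
    have h2 := gamma_add_half_pos n
    have h3 : 0 < Real.Gamma ((n : ℝ) + 1) := Real.Gamma_pos_of_pos (by positivity)
    have := Real.pi_pos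
    positivity
  have hp0 : 0 ≤ Sp.toCLM := nonneg_of_hasSum hθ (a := fun n => decompCoeff θ (2 * n))
    (fun n => mul_nonneg (hc0 _) ((even_two_mul n).pow_nonneg _)) hSpsum
  have hm0 : θ ≤ Real.pi / 2 → 0 ≤ Sm.toCLM := fun h =>
    nonneg_of_hasSum hθ (a := fun n => decompCoeff θ (2 * n + 1))
      (fun n => mul_nonneg (hc0 _) (pow_nonneg (Real.cos_nonneg_of_neg_pi_div_two_le_of_le
        (by linarith [hθ.1]) h) _)) hSmsum
  have hm0' : Real.pi / 2 ≤ θ → 0 ≤ (-Sm).toCLM := fun h =>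
    nonneg_of_hasSum hθ (a := fun n => -decompCoeff θ (2 * n + 1)) (fun n => by
      have hcos : Real.cos θ ≤ 0 :=
        Real.cos_nonpos_of_pi_div_two_le_of_le h (by linarith [hθ.2, Real.pi_pos])
      exact neg_nonneg.2 (mul_nonpos_of_nonneg_of_nonpos (hc0 _)
        ((odd_two_mul_add_one n).pow_nonpos hcos)))
      (hSmsum.neg.congr_fun fun n => neg_smul _ _)
  obtain ⟨htp, htm⟩ := trace_tsum_even_and_odd hθ
  rw [← hSp] at htp
  rw [← hSm] at htm
  have hplus : HasTrace (hatTPlus hθ)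
      (((Real.cos (θ / 2) + Real.sin (θ / 2)) / (2 * √2 * Real.sin θ) : ℝ) : ℂ) := by
    rw [← hSpT, ← htp]
    exact TraceClass.hasTrace_of_nonneg hp0
  have hminus : HasTrace (hatTMinus hθ)
      (((Real.cos (θ / 2) - Real.sin (θ / 2)) / (2 * √2 * Real.sin θ) : ℝ) : ℂ) := by
    rw [← hSmT, ← htm]
    -- Either the odd part or its negative is positive, so its trace exists in every basis.
    rcases le_total θ (Real.pi / 2) with h | h
    · exact TraceClass.hasTrace_of_nonneg (hm0 h)
    · simpa using (TraceClass.hasTrace_of_nonneg (hm0' h)).neg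
  have hsh : 0 < Real.sin (θ / 2) :=
    Real.sin_pos_of_pos_of_lt_pi (by linarith [hθ.1]) (by linarith [hθ.1, hθ.2])
  have hch : 0 < Real.cos (θ / 2) :=
    Real.cos_pos_of_mem_Ioo ⟨by linarith [hθ.1, Real.pi_pos], by linarith [hθ.2]⟩
  have hdouble : Real.sin θ = 2 * Real.sin (θ / 2) * Real.cos (θ / 2) := by
    rw [← Real.sin_two_mul, mul_div_cancel₀ θ two_ne_zero]
  have hcs : θ ≤ Real.pi / 2 → Real.sin (θ / 2) ≤ Real.cos (θ / 2) := fun h => by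
    rw [← Real.cos_pi_div_two_sub]
    exact Real.cos_le_cos_of_nonneg_of_le_pi (by linarith [hθ.1]) (by linarith [hθ.1, Real.pi_pos])
      (by linarith)
  have hcs' : Real.pi / 2 ≤ θ → Real.cos (θ / 2) ≤ Real.sin (θ / 2) := fun h => by
    rw [← Real.cos_pi_div_two_sub]
    exact Real.cos_le_cos_of_nonneg_of_le_pi (by linarith [hθ.2]) (by linarith [hθ.2, Real.pi_pos])
      (by linarith)
  refine ⟨integrableOn_projIntegrand hθ, ⟨S, hST, hSsum⟩, ⟨Sp, hSpT, ?_⟩, ⟨Sm, hSmT, ?_⟩, ?_, ?_,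
    trace_facts_of_fourierConj hplus ?_, trace_facts_of_fourierConj hminus ?_,
    trace_facts_of_fourierConj ?_ ?_⟩
  · refine hSpsum.congr_fun fun n => ?_
    rw [decompTerm, decompCoeff]
    push_cast
    rfl
  · refine hSmsum.congr_fun fun n => ?_
    have h1 : 2 * (n : ℝ) + 1 + 1 / 2 = 2 * n + 3 / 2 := by ring
    have h2 : 2 * (n : ℝ) + 1 + 1 = 2 * n + 2 := by ring
    rw [decompTerm, decompCoeff]
    push_cast
    rw [h1, h2]
  · intro h
    rw [← hSpT, ← hSmT, ← ContinuousLinearMap.nonneg_iff_isPositive,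
      ← ContinuousLinearMap.nonneg_iff_isPositive]
    exact ⟨hp0, hm0 h⟩
  · intro h
    rw [← hSpT, ← hSmT, ← ContinuousLinearMap.nonneg_iff_isPositive,
      ← ContinuousLinearMap.nonneg_iff_isPositive, ← map_neg]
    exact ⟨hp0, hm0' h⟩
  · rw [← hSpT]
    exact TraceClass.traceNorm_of_nonneg hp0 htp
  · rw [← hSmT]
    rcases le_total θ (Real.pi / 2) with h | h
    · rw [abs_of_nonneg (sub_nonneg.2 (hcs h))]
      exact TraceClass.traceNorm_of_nonneg (hm0 h) htm
    · rw [abs_of_nonpos (sub_nonpos.2 (hcs' h)), ← traceNorm_neg, ← map_neg]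
      refine TraceClass.traceNorm_of_nonneg (hm0' h) ?_
      rw [map_neg, htm]
      push_cast
      ring
  · rw [← hatTPlus_add_hatTMinus hθ]
    convert hplus.add hminus using 1
    rw [← Complex.ofReal_add, hdouble]
    congr 1
    field_simp
    ring
  · rcases le_total θ (Real.pi / 2) with h | h
    · have h0 : 0 ≤ (Sp + Sm).toCLM := by rw [map_add]; exact add_nonneg hp0 (hm0 h)
      rw [← hatTPlus_add_hatTMinus hθ, ← hSpT, ← hSmT, ← map_add, max_eq_left (hcs h)]
      refine TraceClass.traceNorm_of_nonneg h0 ?_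
      rw [map_add, htp, htm, ← Complex.ofReal_add]
      congr 1
      field_simp
      ring
    -- Here positivity is available for `Π T̂_θ`, the even part minus the odd part, and
    -- multiplication by the isometry `Π` preserves the trace norm.
    · have h0 : 0 ≤ (Sp + -Sm).toCLM := by rw [map_add]; exact add_nonneg hp0 (hm0' h)
      rw [← traceNorm_mul_left_of_isometry star_parityOp_mul_parityOp, parityOp_mul_hatT hθ,
        ← hSpT, ← hSmT, ← map_sub, sub_eq_add_neg, max_eq_right (hcs' h)]
      refine TraceClass.traceNorm_of_nonneg h0 ?_
      rw [map_add, map_neg, htp, htm, ← Complex.ofReal_neg, ← Complex.ofReal_add]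
      congr 1
      field_simp
      ring
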